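/- Let $\mathcal X,\mathcal Y,\mathcal Z$ be standard Borel spaces and let $X,Y,Z$ be random variables, defined on a common probability space, with values in $\mathcal X,\mathcal Y,\mathcal Z$ respectively. Let $\varphi:\mathcal X\to\mathbb R$, $\psi:\mathcal Y\to\mathbb R$ and $\delta:\mathcal X\times\mathcal Z\to\mathbb R$ be arbitrary Borel isomorphisms onto Borel subsets of $\mathbb R$ (injective measurable maps that send measurable sets to Borel sets). Let $(X_i,Y_i,Z_i)_{i\ge 1}$ be i.i.d. copies of $(X,Y,Z)$, and put $X_i'=\varphi(X_i)$, $Y_i'=\psi(Y_i)$, $W_i'=\delta(X_i,Z_i)$, $Y'=\psi(Y)$. For real data $(x_1,y_1),\ldots,(x_n,y_n)$, let $(x_{(1)},y_{(1)}),\ldots,(x_{(n)},y_{(n)})$ be the rearrangement of the pairs with $x_{(1)}\le\cdots\le x_{(n)}$, ties among the $x_i$ being broken uniformly at random (that is, conditionally on the data, the rearranging permutation is uniformly distributed on the permutations that sort the $x_i$). Let $r_i=\#\{j: y_{(j)}\le y_{(i)}\}$, $l_i=\#\{j: y_{(j)}\ge y_{(i)}\}$ and $$\xi_n := 1-\frac{n\sum_{i=1}^{n-1}|r_{i+1}-r_i|}{2\sum_{i=1}^n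 l_i(n-l_i)}.$$ Let $\xi_n(X,Y)$ be this coefficient for the data $(X_i',Y_i')_{i\le n}$, let $\xi_n((X,Z),Y)$ be this coefficient for the data $(W_i',Y_i')_{i\le n}$, and define $$\xi_n(Z,Y|X):=\frac{\xi_n((X,Z),Y)-\xi_n(X,Y)}{1-\xi_n(X,Y)},$$ which is undefined if a denominator is zero. Let $\mu$ be the law of $Y'$ and let $$T:=\frac{\int \mathbb E\big(\mathrm{Var}(\mathbb P(Y'\ge t\mid Z,X)\mid X)\big)\,d\mu(t)}{\int \mathbb E\big(\mathrm{Var}(1_{\{Y'\ge t\}}\mid X)\big)\,d\mu(t)}.$$ Suppose that $Y$ is not almost surely equal to a measurable function of $X$. Then the denominator of $T$ is positive; almost surely, $\xi_n(Z,Y|X)$ is defined for all sufficiently large $n$ and converges to the deterministic limit $T$ as $n\to\infty$; and $T\in[0,1]$. Moreover, $T=0$ if and only if $Y$ and $Z$ are conditionally independent given $X$, and $T=1$ if and only if $Y$ is almost surely equal to a measurable function of $Z$ given $X$. The latter condition may be understood in either of two ways, and the claim holds for both: there is a measurable $f:\mathcal X\times\mathcal Z\to\mathcal Y$ with $Y=f(X,Z)$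 almost surely; or, for almost every value $x$ of $X$, there is a measurable $f_x:\mathcal Z\to\mathcal Y$ such that $Y=f_x(Z)$ almost surely under the conditional law of $(Y,Z)$ given $X=x$. -/

import Mathlib

open MeasureTheory ProbabilityTheory Filter Topology

noncomputable section

namespace ChatterjeeXi

/-! ### The sample coefficient -/

/-- `r_i`: the number of `j` with `v j ≤ v i`. -/
def lowerRank {n : ℕ} (v : Fin n → ℝ) (i : Fin n) : ℕ :=
  Nat.card {j : Fin n // v j ≤ v i}

/-- `l_i`: the number of `j` with `v j ≥ v i`. -/
def upperRank {n : ℕ} (v : Fin n → ℝ) (i : Fin n) : ℕ :=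
  Nat.card {j : Fin n // v i ≤ v j}

/-- The numerator `n * ∑_{i=1}^{n-1} |r_{i+1} - r_i|` (indices shifted to start at `0`). -/
def xiNum {n : ℕ} (v : Fin n → ℝ) : ℝ :=
  (n : ℝ) * ∑ i : Fin (n - 1),
    |(lowerRank v ⟨i.val + 1, by omega⟩ : ℝ) - (lowerRank v ⟨i.val, by omega⟩ : ℝ)|

/-- The denominator `2 * ∑_i l_i (n - l_i)`. -/
def xiDen {n : ℕ} (v : Fin n → ℝ) : ℝ :=
  2 * ∑ i : Fin n, (upperRank v i : ℝ) * ((n : ℝ) - (upperRank v i : ℝ))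

/-- The coefficient `ξ_n` of real data `y_1, …, y_n`, rearranged along a permutation `s` that puts
the paired values `x_1, …, x_n` in increasing order (so `y (s i)` is the `y`-value paired with the
`i`-th smallest `x`-value). The `x`-values enter only through `s`. -/
def xi {n : ℕ} (s : Equiv.Perm (Fin n)) (y : Fin n → ℝ) : ℝ :=
  1 - xiNum (y ∘ s) / xiDen (y ∘ s)

/-- The conditional coefficient `ξ_n(Z, Y | X) = (ξ_n(W, Y) - ξ_n(X, Y)) / (1 - ξ_n(X, Y))`, where
`sW` sorts the `W`-data, `W = (X, Z)`, and `sX` sorts the `X`-data. -/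
def condXi {n : ℕ} (sW sX : Equiv.Perm (Fin n)) (y : Fin n → ℝ) : ℝ :=
  (xi sW y - xi sX y) / (1 - xi sX y)

open Classical in
/-- The probability of the permutation `s` under the uniform distribution on all permutations
that put `x` in increasing order. -/
def uniformSortProb {n : ℕ} (x : Fin n → ℝ) (s : Equiv.Perm (Fin n)) : ℝ :=
  if Monotone (x ∘ s) then (Nat.card {t : Equiv.Perm (Fin n) // Monotone (x ∘ t)} : ℝ)⁻¹ else 0

/-- The random permutation `σ` is an increasing rearrangement of the data `x` with ties broken
uniformly at random: conditionally on the whole data set `(x_i, y_i)`, it is uniformly distributed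
on the permutations that put `x` in increasing order. -/
structure IsUniformSort {Ω : Type*} [MeasurableSpace Ω] (Q : Measure Ω) {n : ℕ}
    (x y : Fin n → Ω → ℝ) (σ : Ω → Equiv.Perm (Fin n)) : Prop where
  measurableSet_eq : ∀ s : Equiv.Perm (Fin n), MeasurableSet {ω | σ ω = s}
  condProb_eq : ∀ s : Equiv.Perm (Fin n),
    Q⟦{ω | σ ω = s} | MeasurableSpace.comap (fun ω i => (x i ω, y i ω)) inferInstance⟧
      =ᵐ[Q] fun ω => uniformSortProb (fun i => x i ω) s

/-! ### The population quantity -/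

section Population

variable {Ω : Type*} [MeasurableSpace Ω] {𝒳 𝒴 𝒵 : Type*}
  [MeasurableSpace 𝒳] [MeasurableSpace 𝒴] [MeasurableSpace 𝒵]

/-- `∫ E[Var(P(Y ≥ t | Z, X) | X)] dμ(t)`, where `μ` is the law of `Y`. -/
def condDepNum (P : Measure Ω) (Y : Ω → ℝ) (Z : Ω → 𝒵) (X : Ω → 𝒳) : ℝ :=
  ∫ t, (∫ ω, (Var[P⟦{ω' | t ≤ Y ω'} |
      MeasurableSpace.comap (fun ω' => (Z ω', X ω')) inferInstance⟧; P |
      MeasurableSpace.comap X inferInstance]) ω ∂P) ∂(P.map Y)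

/-- `∫ E[Var(1_{Y ≥ t} | X)] dμ(t)`, where `μ` is the law of `Y`. -/
def condDepDen (P : Measure Ω) (Y : Ω → ℝ) (X : Ω → 𝒳) : ℝ :=
  ∫ t, (∫ ω, (Var[{ω' | t ≤ Y ω'}.indicator (fun _ => (1 : ℝ)); P |
      MeasurableSpace.comap X inferInstance]) ω ∂P) ∂(P.map Y)

/-- The Azadkia–Chatterjee quantity `T(Y, Z | X)`. -/
def condDep (P : Measure Ω) (Y : Ω → ℝ) (Z : Ω → 𝒵) (X : Ω → 𝒳) : ℝ :=
  condDepNum P Y Z X / condDepDen P Y X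

/-- `Y` and `Z` are conditionally independent given `X`, on an arbitrary probability space
(Mathlib's `CondIndepFun` needs a standard Borel sample space; see `condIndepGiven_iff`). -/
def CondIndepGiven (P : Measure Ω) (Y : Ω → 𝒴) (Z : Ω → 𝒵) (X : Ω → 𝒳) : Prop :=
  ∀ (A : Set 𝒴) (B : Set 𝒵), MeasurableSet A → MeasurableSet B →
    P⟦Y ⁻¹' A ∩ Z ⁻¹' B | MeasurableSpace.comap X inferInstance⟧ =ᵐ[P]
      P⟦Y ⁻¹' A | MeasurableSpace.comap X inferInstance⟧ *
        P⟦Z ⁻¹' B | MeasurableSpace.comap X inferInstance⟧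

theorem condIndepGiven_iff [StandardBorelSpace Ω] (P : Measure Ω) [IsFiniteMeasure P]
    (Y : Ω → 𝒴) (Z : Ω → 𝒵) (X : Ω → 𝒳) (hY : Measurable Y) (hZ : Measurable Z)
    (hX : Measurable X) :
    CondIndepGiven P Y Z X ↔
      CondIndepFun (MeasurableSpace.comap X inferInstance) hX.comap_le Y Z P := by
  rw [condIndepFun_iff _ _ Y Z hY hZ]
  constructor
  · rintro h _ _ ⟨A, hA, rfl⟩ ⟨B, hB, rfl⟩
    exact h A B hA hB
  · intro h A B hA hB
    exact h _ _ ⟨A, hA, rfl⟩ ⟨B, hB, rfl⟩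

/-- Given `X`, the variable `Y` is almost surely a measurable function of `Z`: for almost every
value `x` of `X`, under the conditional law of `(Y, Z)` given `X = x` there is a measurable `f`
with `Y = f(Z)` almost surely. -/
def IsFunctionOfGiven [StandardBorelSpace 𝒴] [Nonempty 𝒴] [StandardBorelSpace 𝒵] [Nonempty 𝒵]
    (P : Measure Ω) [IsFiniteMeasure P] (Y : Ω → 𝒴) (Z : Ω → 𝒵) (X : Ω → 𝒳) : Prop :=
  ∀ᵐ x ∂(P.map X), ∃ f : 𝒵 → 𝒴, Measurable f ∧
    ∀ᵐ p ∂(condDistrib (fun ω => (Y ω, Z ω)) X P x), p.1 = f p.2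

end Population

end ChatterjeeXi

end

noncomputable section

namespace ChatterjeeXi

/-! ### Ranks and threshold crossings -/

/-! For a σ-algebra `m`, put S(m) = ∫ E Var(1{Y' ≥ t} | m) dμ(t), the integral of `condSpread`. The
theorem rests on one limit: when the sample is sorted along U, ξ_n tends almost surely to 1 -
S(U)/S(trivial). Taking U = φ(X) and U = δ(X, Z), which generate the same σ-algebras as X and (X,
Z), the conditional coefficient tends to (S(X) - S(X, Z))/S(X). The tower property identifies this
quotient with T (`integral_condVar_condProb`).

For the limit, a rank increment is written as a sum over thresholds y_j of crossings, so the
numerator of ξ_n is n times the sum over j of the number of crossings of the level y_j along the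
sorted sample (`xiNum_eq_sum_jumps`). Fix the level t and let g(u) = P(Y' ≥ t | U = u). Given the
U-data, the bits 1{Y_i' ≥ t} are independent with means g(U_i). The sorting permutation is
independent of them, since its conditional law involves the U-data only. An Azuma bound and
Borel-Cantelli replace the number of crossings by its conditional mean. That mean is 2 Σ g(1 - g) up
to the variation of g along the sorted sample, which is o(n) because g is an L¹ limit of functions
of bounded variation (`tendsto_meanChanges_ae`). Hence crossings/n tend to 2 E[g(1 - g)]
(`tendsto_jumps_ae`).

The levels that matter are the random points y_j. When the level moves from s to t, both the
crossing frequency and its limit change by at most a constant times the (empirical, respectively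
true) mass of [s, t), so finitely many levels suffice (`tendsto_avg_of_controlled`). The denominator
of ξ_n is treated likewise, with the trivial σ-algebra.

The extreme values of T come from the same control of increments: a nonnegative spread difference
with zero integral vanishes at every t, not merely at almost every t (`IntervalControlled.eq_zero`).
So T = 0 means that P(Y' ≥ t | Z, X) = P(Y' ≥ t | X) for all t, which is conditional independence. T
= 1 means S(X, Z) = 0, so that all threshold indicators are functions of (X, Z), and then so is Y.
-/

/-- The indicator of `t ≤ v`. -/
def geInd (t v : ℝ) : ℝ := if t ≤ v then 1 else 0

/-- The number of times the sequence `v` crosses the threshold `t`. -/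
def jumps {n : ℕ} (v : Fin n → ℝ) (t : ℝ) : ℝ :=
  ∑ i : Fin (n - 1), |geInd t (v ⟨i.val + 1, by omega⟩) - geInd t (v ⟨i.val, by omega⟩)|

/-- The mean of `f` along the first `n` terms of `v`. -/
def avg {α : Type*} {n : ℕ} (f : α → ℝ) (v : Fin n → α) : ℝ := (∑ j, f (v j)) / n

lemma sum_geInd_eq_card {ι : Type*} [Fintype ι] (a b : ι → ℝ) :
    ∑ j, geInd (a j) (b j) = (Nat.card {j // a j ≤ b j} : ℝ) := by
  classical
  simp only [geInd, Finset.sum_boole, Nat.card_eq_fintype_card, Fintype.card_subtype]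

lemma lowerRank_eq_sum {n : ℕ} (v : Fin n → ℝ) (i : Fin n) :
    (lowerRank v i : ℝ) = ∑ j, geInd (v j) (v i) :=
  (sum_geInd_eq_card _ _).symm

lemma upperRank_eq_sum {n : ℕ} (v : Fin n → ℝ) (i : Fin n) :
    (upperRank v i : ℝ) = ∑ j, geInd (v i) (v j) :=
  (sum_geInd_eq_card _ _).symm

lemma geInd_nonneg (t v : ℝ) : 0 ≤ geInd t v := by
  unfold geInd; split_ifs <;> norm_num

lemma geInd_le_one (t v : ℝ) : geInd t v ≤ 1 := by
  unfold geInd; split_ifs <;> norm_num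

lemma geInd_mono_right (t : ℝ) {v w : ℝ} (h : v ≤ w) : geInd t v ≤ geInd t w := by
  unfold geInd
  split_ifs with h1 h2
  · exact le_rfl
  · exact absurd (h1.trans h) h2
  · norm_num
  · exact le_rfl

lemma geInd_sub {s t : ℝ} (h : s ≤ t) (v : ℝ) :
    geInd s v - geInd t v = (Set.Ico s t).indicator (fun _ => (1 : ℝ)) v := by
  unfold geInd
  by_cases h1 : s ≤ v <;> by_cases h2 : t ≤ v
  · simp [h1, h2]
  · simp [h1, h2, not_le.1 h2]
  · exact absurd (h.trans h2) h1
  · simp [h1, h2]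

/-- `geInd` is monotone in its second argument, so all terms of the rank difference have the same
sign and the absolute value passes inside the sum. -/
lemma abs_lowerRank_sub {n : ℕ} (v : Fin n → ℝ) (i k : Fin n) :
    |(lowerRank v i : ℝ) - lowerRank v k| = ∑ j, |geInd (v j) (v i) - geInd (v j) (v k)| := by
  wlog h : v k ≤ v i generalizing i k
  · rw [abs_sub_comm, this k i (le_of_not_ge h)]
    exact Finset.sum_congr rfl fun j _ => abs_sub_comm _ _
  · rw [lowerRank_eq_sum, lowerRank_eq_sum, ← Finset.sum_sub_distrib, abs_of_nonneg]
    · exact Finset.sum_congr rfl fun j _ =>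
        (abs_of_nonneg (sub_nonneg.2 (geInd_mono_right _ h))).symm
    · exact Finset.sum_nonneg fun j _ => sub_nonneg.2 (geInd_mono_right _ h)

lemma xiNum_eq_sum_jumps {n : ℕ} (v : Fin n → ℝ) : xiNum v = n * ∑ j, jumps v (v j) := by
  simp only [xiNum, jumps, abs_lowerRank_sub]
  rw [Finset.sum_comm]

lemma sum_adjacent_le {n : ℕ} (f : Fin n → ℝ) (hf : ∀ i, 0 ≤ f i) :
    ∑ i : Fin (n - 1), f ⟨i.val, by omega⟩ ≤ ∑ i, f i ∧
      ∑ i : Fin (n - 1), f ⟨i.val + 1, by omega⟩ ≤ ∑ i, f i := by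
  cases n with
  | zero => simp
  | succ m =>
    constructor
    · rw [Fin.sum_univ_castSucc]
      exact le_add_of_nonneg_right (hf _)
    · rw [Fin.sum_univ_succ]
      exact le_add_of_nonneg_left (hf _)

/-- Moving the level from `s` to `t` flips only the bits of points in [s, t), and each index belongs
to at most two adjacent pairs; hence the factor 2. -/
lemma abs_jumps_sub_le {n : ℕ} (v : Fin n → ℝ) {s t : ℝ} (h : s ≤ t) :
    |jumps v s - jumps v t| ≤ 2 * ∑ j, (Set.Ico s t).indicator (fun _ => (1 : ℝ)) (v j) := by
  have h0 : ∀ w : ℝ, 0 ≤ (Set.Ico s t).indicator (fun _ => (1 : ℝ)) w :=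
    fun w => Set.indicator_nonneg (fun _ _ => zero_le_one) w
  obtain ⟨h1, h2⟩ := sum_adjacent_le
    (fun j => (Set.Ico s t).indicator (fun _ => (1 : ℝ)) (v j)) (fun j => h0 _)
  unfold jumps
  rw [← Finset.sum_sub_distrib]
  refine (Finset.abs_sum_le_sum_abs _ _).trans ?_
  rw [two_mul]
  refine le_trans ?_ (add_le_add h2 h1)
  rw [← Finset.sum_add_distrib]
  refine Finset.sum_le_sum fun i _ => (abs_abs_sub_abs_le_abs_sub _ _).trans ?_
  have e : ∀ a b c d : ℝ, a - b - (c - d) = (a - c) - (b - d) := fun a b c d => by ring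
  rw [e, geInd_sub h, geInd_sub h]
  refine (abs_sub _ _).trans (le_of_eq ?_)
  rw [abs_of_nonneg (h0 _), abs_of_nonneg (h0 _)]

lemma abs_sum_geInd_sub {n : ℕ} (v : Fin n → ℝ) {s t : ℝ} (h : s ≤ t) :
    |∑ j, geInd s (v j) - ∑ j, geInd t (v j)|
      = ∑ j, (Set.Ico s t).indicator (fun _ => (1 : ℝ)) (v j) := by
  rw [← Finset.sum_sub_distrib]
  simp only [geInd_sub h]
  exact abs_of_nonneg (Finset.sum_nonneg fun j _ => Set.indicator_nonneg (fun _ _ => zero_le_one) _)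

lemma upperRank_comp_perm {n : ℕ} (v : Fin n → ℝ) (s : Equiv.Perm (Fin n)) (i : Fin n) :
    upperRank (v ∘ s) i = upperRank v (s i) := by
  have h : (upperRank (v ∘ s) i : ℝ) = upperRank v (s i) := by
    rw [upperRank_eq_sum, upperRank_eq_sum]
    exact Equiv.sum_comp s (fun j => geInd (v (s i)) (v j))
  exact_mod_cast h

lemma xiDen_comp_perm {n : ℕ} (v : Fin n → ℝ) (s : Equiv.Perm (Fin n)) :
    xiDen (v ∘ s) = xiDen v := by
  simp only [xiDen, upperRank_comp_perm]
  rw [Equiv.sum_comp s (fun i => (upperRank v i : ℝ) * ((n : ℝ) - upperRank v i))]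

lemma xiNum_comp_perm {n : ℕ} (v : Fin n → ℝ) (s : Equiv.Perm (Fin n)) :
    xiNum (v ∘ s) = n * ∑ j, jumps (v ∘ s) (v j) := by
  rw [xiNum_eq_sum_jumps]
  congr 1
  exact Equiv.sum_comp s (fun j => jumps (v ∘ s) (v j))

/-! ### An exponential moment bound for finite sequences of independent bits -/

/-- The probability of the bit `b` when `true` has probability `p`. -/
def bitProb (p : ℝ) (b : Bool) : ℝ := cond b p (1 - p)

/-- The numerical value of a bit. -/
def bitVal (b : Bool) : ℝ := cond b 1 0

lemma bitProb_nonneg {p : ℝ} (hp : p ∈ Set.Icc (0 : ℝ) 1) (b : Bool) : 0 ≤ bitProb p b := by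
  cases b
  · exact sub_nonneg.2 hp.2
  · exact hp.1

/-- The exponential is expanded to second order; the linear term averages to zero because the bit is
centred, and 1 + l² ≤ exp(l²). -/
lemma bitProb_exp_le {p : ℝ} (hp : p ∈ Set.Icc (0 : ℝ) 1) {l : ℝ} (hl : |l| ≤ 1) :
    ∑ b, bitProb p b * Real.exp ((bitVal b - p) * l) ≤ Real.exp (l ^ 2) := by
  have key : ∀ b, bitProb p b * Real.exp ((bitVal b - p) * l)
      ≤ bitProb p b * (1 + (bitVal b - p) * l + l ^ 2) := by
    intro b
    refine mul_le_mul_of_nonneg_left ?_ (bitProb_nonneg hp b)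
    have h1 : |bitVal b - p| ≤ 1 := by
      rw [abs_le]
      cases b <;> simp only [bitVal, cond_true, cond_false] <;> constructor <;>
        linarith [hp.1, hp.2]
    have h2 : |(bitVal b - p) * l| ≤ |l| := by
      rw [abs_mul]; exact mul_le_of_le_one_left (abs_nonneg _) h1
    have h3 := (abs_le.1 (Real.abs_exp_sub_one_sub_id_le (h2.trans hl))).2
    have h4 : ((bitVal b - p) * l) ^ 2 ≤ l ^ 2 := sq_le_sq.2 h2
    linarith
  refine (Finset.sum_le_sum fun b _ => key b).trans ?_
  have : ∑ b, bitProb p b * (1 + (bitVal b - p) * l + l ^ 2) = l ^ 2 + 1 := by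
    simp only [Fintype.sum_bool, bitProb, bitVal, cond_true, cond_false]
    ring
  rw [this]
  exact Real.add_one_le_exp _

/-- Azuma's inequality for bits: the increment at time `i` may depend on the preceding bit. -/
lemma sum_prod_bitProb_mul_exp_le {K l : ℝ} (hl : |l| * K ≤ 1) :
    ∀ {n : ℕ} (p : Fin n → ℝ) (_ : ∀ i, p i ∈ Set.Icc (0 : ℝ) 1) (m : Fin n → Bool → ℝ)
      (_ : ∀ i b, |m i b| ≤ K) (a : Bool),
    ∑ c : Fin n → Bool, (∏ i, bitProb (p i) (c i)) *
        Real.exp (l * ∑ i, (bitVal (c i) - p i) * m i ((Fin.cons a c : Fin (n + 1) → Bool) i.castSucc))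
      ≤ Real.exp (n * (l * K) ^ 2) := by
  intro n
  induction n with
  | zero => intro p hp m hm a; simp
  | succ n ih =>
    intro p hp m hm a
    -- Split off the first bit `b`. For the remaining bits `b` plays the role of the preceding bit,
    -- so the induction hypothesis is needed for every value of `a`.
    rw [← (Fin.consEquiv (fun _ : Fin (n + 1) => Bool)).sum_comp, Fintype.sum_prod_type]
    have step : ∀ (b : Bool) (c : Fin n → Bool),
        (∏ i, bitProb (p i) ((Fin.consEquiv (fun _ : Fin (n + 1) => Bool)) (b, c) i)) *
        Real.exp (l * ∑ i, (bitVal ((Fin.consEquiv (fun _ : Fin (n + 1) => Bool)) (b, c) i) - p i) *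
          m i ((Fin.cons a ((Fin.consEquiv (fun _ : Fin (n + 1) => Bool)) (b, c)) :
            Fin (n + 2) → Bool) i.castSucc))
        = (bitProb (p 0) b * Real.exp ((bitVal b - p 0) * (l * m 0 a))) *
          ((∏ i : Fin n, bitProb (p i.succ) (c i)) *
            Real.exp (l * ∑ i : Fin n, (bitVal (c i) - p i.succ) *
              m i.succ ((Fin.cons b c : Fin (n + 1) → Bool) i.castSucc))) := by
      intro b c
      simp only [Fin.consEquiv_apply]
      rw [Fin.prod_univ_succ, Fin.sum_univ_succ]
      simp only [Fin.cons_zero, Fin.cons_succ, Fin.castSucc_zero, ← Fin.succ_castSucc]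
      rw [mul_add, Real.exp_add]
      have : l * ((bitVal b - p 0) * m 0 a) = (bitVal b - p 0) * (l * m 0 a) := by ring
      rw [this, mul_mul_mul_comm]
      rfl
    simp only [step, ← Finset.mul_sum]
    have hK : |l * m 0 a| ≤ |l| * K := by
      rw [abs_mul]; exact mul_le_mul_of_nonneg_left (hm _ _) (abs_nonneg _)
    calc _ ≤ ∑ b, (bitProb (p 0) b * Real.exp ((bitVal b - p 0) * (l * m 0 a))) *
          Real.exp (n * (l * K) ^ 2) :=
          Finset.sum_le_sum fun b _ => mul_le_mul_of_nonneg_left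
            (ih (fun i => p i.succ) (fun i => hp _) (fun i => m i.succ) (fun i => hm _) b)
            (mul_nonneg (bitProb_nonneg (hp 0) b) (Real.exp_pos _).le)
      _ ≤ Real.exp ((l * m 0 a) ^ 2) * Real.exp (n * (l * K) ^ 2) := by
          rw [← Finset.sum_mul]
          exact mul_le_mul_of_nonneg_right (bitProb_exp_le (hp 0) (hK.trans hl)) (Real.exp_pos _).le
      _ ≤ Real.exp ((n + 1 : ℕ) * (l * K) ^ 2) := by
          rw [← Real.exp_add, Real.exp_le_exp]
          have h : (l * m 0 a) ^ 2 ≤ (l * K) ^ 2 := by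
            rw [sq_le_sq, abs_mul l K]
            exact hK.trans (mul_le_mul_of_nonneg_left (le_abs_self K) (abs_nonneg _))
          push_cast
          linarith

/-- The number of changes along a sequence of bits. -/
def bitChanges {n : ℕ} (c : Fin n → Bool) : ℝ :=
  ∑ i : Fin (n - 1), |bitVal (c ⟨i.val + 1, by omega⟩) - bitVal (c ⟨i.val, by omega⟩)|

/-- The expected number of changes along a sequence of independent bits. -/
def meanChanges {n : ℕ} (p : Fin n → ℝ) : ℝ :=
  ∑ i : Fin (n - 1), (p ⟨i.val + 1, by omega⟩ + p ⟨i.val, by omega⟩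
    - 2 * p ⟨i.val, by omega⟩ * p ⟨i.val + 1, by omega⟩)

/-- The coefficient of the centred bit in the martingale decomposition of the number of changes. -/
def changeCoeff {n : ℕ} (p : Fin n → ℝ) (i : Fin n) (b : Bool) : ℝ :=
  (if h : i.val + 1 < n then 1 - 2 * p ⟨i.val + 1, h⟩ else 0) +
    (if i.val = 0 then 0 else 1 - 2 * bitVal b)

lemma abs_changeCoeff_le {n : ℕ} {p : Fin n → ℝ} (hp : ∀ i, p i ∈ Set.Icc (0 : ℝ) 1)
    (i : Fin n) (b : Bool) : |changeCoeff p i b| ≤ 2 := by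
  have h1 : |(if h : i.val + 1 < n then 1 - 2 * p ⟨i.val + 1, h⟩ else 0)| ≤ 1 := by
    split_ifs with h
    · rw [abs_le]; constructor <;> linarith [(hp ⟨i.val + 1, h⟩).1, (hp ⟨i.val + 1, h⟩).2]
    · simp
  have h2 : |(if i.val = 0 then 0 else 1 - 2 * bitVal b)| ≤ 1 := by
    split_ifs with h
    · simp
    · cases b <;> norm_num [bitVal]
  exact (abs_add_le _ _).trans (by linarith)

/-- For consecutive bits c, c' with means p, p', one has |c' - c| = c + c' - 2cc', whose centred
version is (c' - p')(1 - 2c) + (c - p)(1 - 2p'). Collecting the terms at each index gives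
`changeCoeff`. The artificial initial bit `a` has no effect, since the coefficient at index 0
ignores its bit. -/
lemma bitChanges_sub_meanChanges {n : ℕ} (p : Fin n → ℝ) (c : Fin n → Bool) (a : Bool) :
    bitChanges c - meanChanges p = ∑ i, (bitVal (c i) - p i) *
      changeCoeff p i ((Fin.cons a c : Fin (n + 1) → Bool) i.castSucc) := by
  cases n with
  | zero => simp [bitChanges, meanChanges]
  | succ m =>
    have habs : ∀ b b' : Bool, |bitVal b - bitVal b'| =
        bitVal b + bitVal b' - 2 * bitVal b' * bitVal b := by
      intro b b'; cases b <;> cases b' <;> norm_num [bitVal]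
    simp only [changeCoeff, mul_add, Finset.sum_add_distrib]
    rw [Fin.sum_univ_castSucc (f := fun i : Fin (m + 1) => (bitVal (c i) - p i) *
        (if h : i.val + 1 < m + 1 then 1 - 2 * p ⟨i.val + 1, h⟩ else 0)),
      Fin.sum_univ_succ (f := fun i : Fin (m + 1) => (bitVal (c i) - p i) *
        (if i.val = 0 then 0
          else 1 - 2 * bitVal ((Fin.cons a c : Fin (m + 2) → Bool) i.castSucc)))]
    simp only [Fin.val_last, lt_irrefl, dite_false, mul_zero, add_zero, Fin.val_zero, if_true,
      zero_add, ← Fin.succ_castSucc, Fin.cons_succ, Fin.val_succ, Fin.val_castSucc]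
    rw [← Finset.sum_add_distrib]
    unfold bitChanges meanChanges
    rw [← Finset.sum_sub_distrib]
    refine Finset.sum_congr rfl fun i _ => ?_
    have hi : i.val + 1 < m + 1 := Nat.succ_lt_succ i.isLt
    rw [habs, dif_pos hi, if_neg (Nat.succ_ne_zero _)]
    have e1 : (⟨i.val, by omega⟩ : Fin (m + 1)) = i.castSucc := rfl
    have e2 : (⟨i.val + 1, hi⟩ : Fin (m + 1)) = i.succ := rfl
    simp only [e1, e2]
    ring

lemma sum_prod_bitProb_tail_le {n : ℕ} (p : Fin n → ℝ) (hp : ∀ i, p i ∈ Set.Icc (0 : ℝ) 1)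
    {m : Fin n → Bool → ℝ} (hm : ∀ i b, |m i b| ≤ 2) (a : Bool) {ε : ℝ} (h0 : 0 ≤ ε) (h1 : ε ≤ 1) :
    ∑ c : Fin n → Bool, (∏ i, bitProb (p i) (c i)) *
      (if n * ε ≤ ∑ i, (bitVal (c i) - p i) * m i ((Fin.cons a c : Fin (n + 1) → Bool) i.castSucc)
        then 1 else 0) ≤ Real.exp (-(ε ^ 2 / 16)) ^ n := by
  -- Chernoff's bound with l = ε/8, the minimiser of n(2l)² - l·nε; the minimum is -nε²/16.
  have hl : |ε / 8| * 2 ≤ 1 := by rw [abs_of_nonneg (by positivity)]; linarith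
  have h := sum_prod_bitProb_mul_exp_le hl p hp m hm a
  have hpos : 0 < Real.exp (ε / 8 * (n * ε)) := Real.exp_pos _
  rw [← Real.exp_nat_mul]
  have e : Real.exp (n * -(ε ^ 2 / 16)) =
      Real.exp (n * (ε / 8 * 2) ^ 2) / Real.exp (ε / 8 * (n * ε)) := by
    rw [← Real.exp_sub]; congr 1; ring
  rw [e, le_div_iff₀ hpos, Finset.sum_mul]
  refine le_trans (Finset.sum_le_sum fun c _ => ?_) h
  rw [mul_assoc]
  refine mul_le_mul_of_nonneg_left ?_ (Finset.prod_nonneg fun i _ => bitProb_nonneg (hp i) _)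
  split_ifs with h2
  · rw [one_mul, Real.exp_le_exp]
    exact mul_le_mul_of_nonneg_left h2 (by positivity)
  · rw [zero_mul]; exact (Real.exp_pos _).le

/-- The number of changes along independent bits concentrates around its mean. -/
lemma sum_prod_bitProb_bitChanges_le {n : ℕ} (p : Fin n → ℝ) (hp : ∀ i, p i ∈ Set.Icc (0 : ℝ) 1)
    {ε : ℝ} (h0 : 0 ≤ ε) (h1 : ε ≤ 1) :
    ∑ c : Fin n → Bool, (∏ i, bitProb (p i) (c i)) *
      (if n * ε ≤ |bitChanges c - meanChanges p| then 1 else 0)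
      ≤ 2 * Real.exp (-(ε ^ 2 / 16)) ^ n := by
  have hm := abs_changeCoeff_le hp
  have hm' : ∀ i b, |-changeCoeff p i b| ≤ 2 := fun i b => by rw [abs_neg]; exact hm i b
  have t1 := sum_prod_bitProb_tail_le p hp hm true h0 h1
  have t2 := sum_prod_bitProb_tail_le p hp hm' true h0 h1
  rw [two_mul]
  refine le_trans ?_ (add_le_add t1 t2)
  rw [← Finset.sum_add_distrib]
  refine Finset.sum_le_sum fun c _ => ?_
  rw [← mul_add]
  refine mul_le_mul_of_nonneg_left ?_ (Finset.prod_nonneg fun i _ => bitProb_nonneg (hp i) _)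
  simp only [mul_neg, Finset.sum_neg_distrib]
  rw [← bitChanges_sub_meanChanges p c true]
  rcases abs_cases (bitChanges c - meanChanges p) with ⟨h, _⟩ | ⟨h, _⟩ <;> rw [h] <;>
    split_ifs <;> norm_num

/-! ### Approximation by functions of bounded variation -/

/-- Measurable functions whose variation along increasing finite sequences is bounded. -/
def HasBoundedVar (h : ℝ → ℝ) : Prop :=
  Measurable h ∧ ∃ C : ℝ, ∀ (n : ℕ) (u : Fin n → ℝ), Monotone u →
    ∑ i : Fin (n - 1), |h (u ⟨i.val + 1, by omega⟩) - h (u ⟨i.val, by omega⟩)| ≤ C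

lemma HasBoundedVar.add {g h : ℝ → ℝ} (hg : HasBoundedVar g) (hh : HasBoundedVar h) :
    HasBoundedVar (g + h) := by
  obtain ⟨mg, C, hC⟩ := hg
  obtain ⟨mh, D, hD⟩ := hh
  refine ⟨mg.add mh, C + D, fun n u hu => le_trans ?_ (add_le_add (hC n u hu) (hD n u hu))⟩
  rw [← Finset.sum_add_distrib]
  refine Finset.sum_le_sum fun i _ => ?_
  simp only [Pi.add_apply]
  rw [add_sub_add_comm]
  exact abs_add_le _ _

lemma HasBoundedVar.const_mul {h : ℝ → ℝ} (hh : HasBoundedVar h) (a : ℝ) :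
    HasBoundedVar (fun x => a * h x) := by
  obtain ⟨mh, D, hD⟩ := hh
  refine ⟨mh.const_mul a, |a| * D, fun n u hu =>
    le_trans (le_of_eq ?_) (mul_le_mul_of_nonneg_left (hD n u hu) (abs_nonneg a))⟩
  rw [Finset.mul_sum]
  exact Finset.sum_congr rfl fun i _ => by rw [← mul_sub, abs_mul]

lemma HasBoundedVar.const (a : ℝ) : HasBoundedVar (fun _ => a) :=
  ⟨measurable_const, 0, fun n u _ => by simp⟩

lemma sum_abs_sub_antitone {n : ℕ} (f : Fin n → ℝ) (hf : Antitone f)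
    (h01 : ∀ i, f i ∈ Set.Icc (0 : ℝ) 1) :
    ∑ i : Fin (n - 1), |f ⟨i.val + 1, by omega⟩ - f ⟨i.val, by omega⟩| ≤ 1 := by
  cases n with
  | zero => simp
  | succ m =>
    have e : ∀ i : Fin m, |f i.succ - f i.castSucc| = f i.castSucc - f i.succ := fun i => by
      rw [abs_sub_comm, abs_of_nonneg]
      exact sub_nonneg.2 (hf (Fin.castSucc_lt_succ).le)
    calc _ = ∑ i : Fin m, |f i.succ - f i.castSucc| := rfl
      _ = ∑ i : Fin m, f i.castSucc - ∑ i : Fin m, f i.succ := by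
        rw [← Finset.sum_sub_distrib]; exact Finset.sum_congr rfl fun i _ => e i
      _ = f 0 - f (Fin.last m) := by
        have h1 := Fin.sum_univ_castSucc f
        have h2 := Fin.sum_univ_succ f
        linarith
      _ ≤ 1 := by linarith [(h01 0).2, (h01 (Fin.last m)).1]

lemma HasBoundedVar.indicator_Iic (a : ℝ) :
    HasBoundedVar ((Set.Iic a).indicator fun _ => (1 : ℝ)) := by
  refine ⟨measurable_const.indicator measurableSet_Iic, 1, fun n u hu => ?_⟩
  refine sum_abs_sub_antitone (fun i => (Set.Iic a).indicator (fun _ => (1 : ℝ)) (u i)) ?_ ?_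
  · intro i j hij
    by_cases h : u j ≤ a
    · simp [h, (hu hij).trans h]
    · simp only [Set.indicator, Set.mem_Iic, h, if_false]
      split_ifs <;> norm_num
  · intro i
    simp only [Set.indicator]
    split_ifs <;> simp

/-- `f` is a limit in `L¹(ν)` of functions of bounded variation. -/
def ApproxBV (ν : Measure ℝ) (f : ℝ → ℝ) : Prop :=
  ∀ ε : ENNReal, ε ≠ 0 → ∃ h, eLpNorm (h - f) 1 ν ≤ ε ∧ HasBoundedVar h

lemma ApproxBV.of_approx {ν : Measure ℝ} {f : ℝ → ℝ} (hf : Measurable f)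
    (H : ∀ ε : ENNReal, ε ≠ 0 → ∃ g, Measurable g ∧ eLpNorm (g - f) 1 ν ≤ ε ∧ ApproxBV ν g) :
    ApproxBV ν f := by
  intro ε hε
  have h2 : ε / 2 ≠ 0 := (ENNReal.half_pos hε).ne'
  obtain ⟨g, mg, hg, hga⟩ := H _ h2
  obtain ⟨h, hh, hb⟩ := hga _ h2
  refine ⟨h, ?_, hb⟩
  have e : h - f = (h - g) + (g - f) := by abel
  rw [e]
  refine (eLpNorm_add_le (hb.1.sub mg).aestronglyMeasurable
    (mg.sub hf).aestronglyMeasurable le_rfl).trans ?_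
  exact (add_le_add hh hg).trans (ENNReal.add_halves ε).le

lemma ApproxBV.add {ν : Measure ℝ} {f g : ℝ → ℝ} (mf : Measurable f) (mg : Measurable g)
    (hf : ApproxBV ν f) (hg : ApproxBV ν g) : ApproxBV ν (f + g) := by
  intro ε hε
  have h2 : ε / 2 ≠ 0 := (ENNReal.half_pos hε).ne'
  obtain ⟨h, hh, hb⟩ := hf _ h2
  obtain ⟨k, hk, kb⟩ := hg _ h2
  refine ⟨h + k, ?_, hb.add kb⟩
  rw [add_sub_add_comm]
  refine (eLpNorm_add_le (hb.1.sub mf).aestronglyMeasurable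
    (kb.1.sub mg).aestronglyMeasurable le_rfl).trans ?_
  exact (add_le_add hh hk).trans (ENNReal.add_halves ε).le

lemma HasBoundedVar.approxBV {ν : Measure ℝ} {h : ℝ → ℝ} (hh : HasBoundedVar h) :
    ApproxBV ν h := fun ε _ => ⟨h, by simp, hh⟩

lemma eLpNorm_one_indicator_one {ν : Measure ℝ} {s : Set ℝ} (hs : MeasurableSet s) :
    eLpNorm (s.indicator fun _ => (1 : ℝ)) 1 ν = ν s := by
  rw [eLpNorm_indicator_const hs one_ne_zero ENNReal.one_ne_top]
  simp

/-- A π-λ argument from the half-lines `Iic a`. Complements replace h by 1 - h; a countable disjoint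
union is approximated by its finite partial unions, the remainder having small mass because ν is
finite. -/
lemma approxBV_indicator_one (ν : Measure ℝ) [IsFiniteMeasure ν] {s : Set ℝ}
    (hs : MeasurableSet s) : ApproxBV ν (s.indicator fun _ => (1 : ℝ)) := by
  have heq : (inferInstance : MeasurableSpace ℝ) = MeasurableSpace.generateFrom (Set.range Set.Iic) := by
    rw [← borel_eq_generateFrom_Iic]; exact BorelSpace.measurable_eq
  induction s, hs using MeasurableSpace.induction_on_inter heq isPiSystem_Iic with
  | empty =>
    simp only [Set.indicator_empty]
    exact (HasBoundedVar.const 0).approxBV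
  | basic t ht =>
    obtain ⟨a, rfl⟩ := ht
    exact (HasBoundedVar.indicator_Iic a).approxBV
  | compl t ht ih =>
    intro ε hε
    obtain ⟨h, hh, hb⟩ := ih ε hε
    refine ⟨(fun _ => 1) + fun x => (-1) * h x, ?_, (HasBoundedVar.const 1).add (hb.const_mul _)⟩
    have e : ((fun _ => (1 : ℝ)) + fun x => (-1) * h x) - tᶜ.indicator (fun _ => (1 : ℝ))
        = -(h - t.indicator fun _ => (1 : ℝ)) := by
      ext x
      by_cases hx : x ∈ t
      · simp [hx]; ring
      · simp [hx]
    rw [e, eLpNorm_neg]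
    exact hh
  | iUnion f hd hm ih =>
    have macc : ∀ n, MeasurableSet (Set.accumulate f n) := fun n =>
      MeasurableSet.biUnion (Set.to_countable _) fun i _ => hm i
    have hacc : ∀ n, ApproxBV ν ((Set.accumulate f n).indicator fun _ => (1 : ℝ)) := by
      intro n
      induction n with
      | zero => simpa [Set.accumulate_zero_nat] using ih 0
      | succ n ihn =>
        rw [Set.accumulate_succ, Set.indicator_union_of_disjoint]
        · exact ApproxBV.add (measurable_const.indicator (macc n))
            (measurable_const.indicator (hm _)) ihn (ih _)
        · exact Set.disjoint_accumulate hd (Nat.lt_succ_self n)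
    have mU := MeasurableSet.iUnion hm
    refine ApproxBV.of_approx (measurable_const.indicator mU) fun ε hε => ?_
    have hsub : ∀ n, Set.accumulate f n ⊆ ⋃ i, f i := fun n =>
      Set.accumulate_subset_iUnion n
    have ht : Tendsto (fun n => ν ((⋃ i, f i) \ Set.accumulate f n)) atTop (𝓝 0) := by
      have h1 := tendsto_measure_iUnion_accumulate (μ := ν) (f := f)
      have h2 := ENNReal.Tendsto.sub (tendsto_const_nhds (x := ν (⋃ i, f i)) (f := atTop (α := ℕ)))
        h1 (Or.inl (measure_ne_top _ _))
      rw [tsub_self] at h2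
      refine h2.congr fun n => ?_
      rw [measure_sdiff (hsub n) (macc n).nullMeasurableSet (measure_ne_top _ _)]
    obtain ⟨n, hn⟩ := ((ENNReal.tendsto_nhds_zero.1 ht) ε (pos_iff_ne_zero.2 hε)).exists
    refine ⟨_, measurable_const.indicator (macc n), ?_, hacc n⟩
    rw [← eLpNorm_neg, neg_sub, ← Set.indicator_sdiff (hsub n)]
    rw [eLpNorm_one_indicator_one (mU.diff (macc n))]
    exact hn

/-- Scaled indicators are approximable, and `MemLp.induction_dense` extends this to all of L¹. This
is what makes a merely measurable conditional probability vary little along sorted data. -/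
lemma exists_hasBoundedVar_integral_abs_sub_le (ν : Measure ℝ) [IsFiniteMeasure ν] {f : ℝ → ℝ}
    (hf : Integrable f ν) {ε : ℝ} (hε : 0 < ε) :
    ∃ h, HasBoundedVar h ∧ Integrable (fun x => |f x - h x|) ν ∧ ∫ x, |f x - h x| ∂ν ≤ ε := by
  have hε' : ENNReal.ofReal ε ≠ 0 := (ENNReal.ofReal_pos.2 hε).ne'
  have H : ∀ (c : ℝ) ⦃s : Set ℝ⦄, MeasurableSet s → ν s < ⊤ → ∀ {δ : ENNReal}, δ ≠ 0 →
      ∃ g, eLpNorm (g - s.indicator fun _ => c) 1 ν ≤ δ ∧ HasBoundedVar g := by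
    intro c s hs _ δ hδ
    by_cases hc : c = 0
    · refine ⟨fun _ => 0, ?_, HasBoundedVar.const 0⟩
      subst hc
      have : ((fun _ => (0 : ℝ)) - s.indicator fun _ => (0 : ℝ)) = 0 := by ext; simp
      rw [this]; simp
    have hc' : ‖c‖ₑ ≠ 0 := by simpa using hc
    obtain ⟨h, hh, hb⟩ := approxBV_indicator_one ν hs (δ / ‖c‖ₑ)
      (ENNReal.div_pos hδ enorm_ne_top).ne'
    refine ⟨fun x => c * h x, ?_, hb.const_mul c⟩
    have e : (fun x => c * h x) - s.indicator (fun _ => c)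
        = c • (h - s.indicator fun _ => (1 : ℝ)) := by
      ext x
      by_cases hx : x ∈ s <;> simp [hx, mul_sub]
    rw [e, eLpNorm_const_smul]
    calc _ ≤ ‖c‖ₑ * (δ / ‖c‖ₑ) := by gcongr
      _ = δ := ENNReal.mul_div_cancel hc' enorm_ne_top
  obtain ⟨h, hh, hb⟩ := MemLp.induction_dense (p := 1) ENNReal.one_ne_top HasBoundedVar
    (μ := ν) (E := ℝ) H (fun f g => HasBoundedVar.add)
    (fun f hf => hf.1.aestronglyMeasurable) (memLp_one_iff_integrable.2 hf) hε'
  have mm : AEStronglyMeasurable (f - h) ν := hf.1.sub hb.1.aestronglyMeasurable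
  have hi : Integrable (f - h) ν :=
    memLp_one_iff_integrable.1 ⟨mm, hh.trans_lt ENNReal.ofReal_lt_top⟩
  refine ⟨h, hb, hi.abs, ?_⟩
  rw [eLpNorm_one_eq_lintegral_enorm, ← ofReal_integral_norm_eq_lintegral_enorm hi] at hh
  exact (ENNReal.ofReal_le_ofReal_iff hε.le).1 hh

/-! ### Functions controlled by the mass of intervals -/

/-- With F(t) = μ(-∞, t), the cells are the level sets of ⌊F/ε⌋. There are finitely many, and s ≤ t
in the same cell gives μ[s, t) = F(t) - F(s) < ε, even if μ has atoms. -/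
lemma exists_rounding (μ : Measure ℝ) [IsProbabilityMeasure μ] {ε : ℝ} (hε : 0 < ε) :
    ∃ (k : ℝ → ℕ) (K : ℕ) (J : ℕ → Set ℝ), Measurable k ∧ (∀ t, k t < K) ∧
      (∀ i, MeasurableSet (J i)) ∧ (∀ i, μ.real (J i) ≤ ε) ∧
      ∀ s t, k s = k t → Set.Ico s t ⊆ J (k t) := by
  set F : ℝ → ℝ := fun t => μ.real (Set.Iio t) with hF
  have F0 : ∀ t, 0 ≤ F t := fun t => measureReal_nonneg
  have Fmono : Monotone F := fun s t h => measureReal_mono (Set.Iio_subset_Iio h)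
  set k : ℝ → ℕ := fun t => ⌊F t / ε⌋₊ with hk
  have kmono : Monotone k := fun s t h =>
    Nat.floor_mono (div_le_div_of_nonneg_right (Fmono h) hε.le)
  -- The greatest point of a cell, if there is one, is left out: it may carry a large atom, and it
  -- lies in no `Ico s t` with both ends in the cell.
  set J : ℕ → Set ℝ := fun i => {s | k s = i ∧ ∃ t, k t = i ∧ s < t} with hJ
  have mJ : ∀ i, MeasurableSet (J i) := by
    intro i
    refine Set.OrdConnected.measurableSet ⟨?_⟩
    rintro x ⟨hx, _⟩ y ⟨hy, t, ht, hyt⟩ z ⟨hxz, hzy⟩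
    exact ⟨le_antisymm ((kmono hzy).trans hy.le) (hx.ge.trans (kmono hxz)), t, ht,
      hzy.trans_lt hyt⟩
  refine ⟨k, ⌊1 / ε⌋₊ + 1, J, kmono.measurable, fun t => ?_, mJ, fun i => ?_, ?_⟩
  · exact Nat.lt_succ_of_le (Nat.floor_mono (div_le_div_of_nonneg_right measureReal_le_one hε.le))
  -- Inner regularity reduces the bound to one interval: a compact subset of `J i` lies in [m, t),
  -- where m is its minimum and t is a point of the cell above its maximum.
  · by_contra! hlt
    have hlt' : ENNReal.ofReal ε < μ (J i) := by
      rw [← ofReal_measureReal]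
      exact (ENNReal.ofReal_lt_ofReal_iff (hε.trans hlt)).2 hlt
    obtain ⟨C, hC, hCc, hCμ⟩ := (mJ i).exists_lt_isCompact hlt'
    have hne : C.Nonempty := by
      rw [Set.nonempty_iff_ne_empty]
      rintro rfl
      simp at hCμ
    obtain ⟨m, hm⟩ := hCc.exists_isLeast hne
    obtain ⟨M, hM⟩ := hCc.exists_isGreatest hne
    obtain ⟨hkm, -⟩ := hC hm.1
    obtain ⟨-, t, hkt, hMt⟩ := hC hM.1
    have hsub : C ⊆ Set.Ico m t := fun z hz => ⟨hm.2 hz, (hM.2 hz).trans_lt hMt⟩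
    have hmt : m ≤ t := (hm.2 hM.1).trans hMt.le
    have hd : μ.real (Set.Ico m t) = F t - F m := by
      have : Set.Ico m t = Set.Iio t \ Set.Iio m := by ext z; simp
      rw [this, measureReal_sdiff (Set.Iio_subset_Iio hmt) measurableSet_Iio]
    have h1 : F t / ε < i + 1 := by
      rw [← hkt]; exact Nat.lt_floor_add_one _
    have h2 : (i : ℝ) ≤ F m / ε := by
      rw [← hkm]; exact Nat.floor_le (div_nonneg (F0 m) hε.le)
    rw [div_lt_iff₀ hε] at h1
    rw [le_div_iff₀ hε] at h2
    have h3 : μ.real (Set.Ico m t) < ε := by rw [hd]; linarith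
    have h4 : ENNReal.ofReal ε < μ (Set.Ico m t) := hCμ.trans_le (measure_mono hsub)
    rw [← ofReal_measureReal] at h4
    exact absurd ((ENNReal.ofReal_lt_ofReal_iff_of_nonneg hε.le).1 h4) (not_lt.2 h3.le)
  · intro s t hst z hz
    exact ⟨le_antisymm (kmono hz.2.le) (hst.ge.trans (kmono hz.1)), t, rfl, hz.2⟩

/-- A function whose increments are controlled by the mass of intervals. -/
def IntervalControlled (μ : Measure ℝ) (a : ℝ → ℝ) : Prop :=
  ∃ C : ℝ, 0 < C ∧ (∀ s t, s ≤ t → |a s - a t| ≤ C * μ.real (Set.Ico s t)) ∧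
    ∀ t, |a t| ≤ C * μ.real (Set.Ici t)

/-- If a(t) ≠ 0, every zero s ≥ t is separated from t by mass μ[t, s) ≥ η = |a(t)|/C. Let M be the
set of s with this separation and r = inf M. Almost every s ≥ t is in M, so μ[t, r] = 0; points of M
decreasing to r then give intervals of vanishing mass, a contradiction. -/
lemma IntervalControlled.eq_zero {μ : Measure ℝ} [IsProbabilityMeasure μ] {a : ℝ → ℝ}
    (ha : IntervalControlled μ a) (h0 : ∀ᵐ t ∂μ, a t = 0) (t : ℝ) : a t = 0 := by
  obtain ⟨C, hC, h1, h2⟩ := ha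
  by_contra hne
  have hpos : 0 < |a t| := abs_pos.2 hne
  set η : ℝ := |a t| / C with hη
  have hηpos : 0 < η := div_pos hpos hC
  set M : Set ℝ := {s | t ≤ s ∧ η ≤ μ.real (Set.Ico t s)} with hM
  have hN : μ {s | t ≤ s ∧ s ∉ M} = 0 := by
    refine measure_mono_null ?_ h0
    rintro s ⟨hs, hsM⟩ hs0
    have hs0' : a s = 0 := hs0
    refine hsM ⟨hs, ?_⟩
    have := h1 t s hs
    rw [hs0', sub_zero] at this
    rw [hη, div_le_iff₀ hC, mul_comm]
    exact this
  -- If M were empty, [t, ∞) would be null and the tail bound |a(t)| ≤ Cμ[t, ∞) would force a(t) =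
  -- 0.
  have hMne : M.Nonempty := by
    by_contra hemp
    have : μ (Set.Ici t) = 0 := measure_mono_null (t := {s | t ≤ s ∧ s ∉ M})
      (fun s hs => ⟨hs, fun hsM => hemp ⟨s, hsM⟩⟩) hN
    have h3 := h2 t
    rw [measureReal_def, this] at h3
    simp at h3
    exact hne h3
  have hbdd : BddBelow M := ⟨t, fun s hs => hs.1⟩
  set r := sInf M with hr
  have htr : t ≤ r := le_csInf hMne fun s hs => hs.1
  have hIco : μ (Set.Ico t r) = 0 := measure_mono_null
    (t := {s | t ≤ s ∧ s ∉ M})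
    (fun s hs => ⟨hs.1, fun hsM => absurd (csInf_le hbdd hsM) (not_le.2 hs.2)⟩) hN
  have hrM : r ∉ M := fun h => by
    have := h.2
    rw [measureReal_def, hIco] at this
    simp at this
    linarith
  have hr0 : μ {r} = 0 := measure_mono_null (fun s hs => by
    rw [Set.mem_singleton_iff] at hs; subst hs; exact ⟨htr, hrM⟩) hN
  have hIcc : μ (Set.Icc t r) = 0 := by
    rw [← Set.Ico_union_right htr]
    exact measure_union_null hIco hr0
  obtain ⟨u, hanti, hu, hulim, huM⟩ := (isGLB_csInf hMne hbdd).exists_seq_strictAnti_tendsto_of_notMem hrM hMne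
  have hlim : Tendsto (fun n => μ (Set.Ioo r (u n))) atTop (𝓝 0) := by
    have hant : Antitone fun n => Set.Ioo r (u n) := fun m n hmn =>
      Set.Ioo_subset_Ioo_right (hanti.antitone hmn)
    have h4 := tendsto_measure_iInter_atTop (μ := μ) (s := fun n => Set.Ioo r (u n))
      (fun n => measurableSet_Ioo.nullMeasurableSet) hant ⟨0, measure_ne_top _ _⟩
    have h5 : ⋂ n, Set.Ioo r (u n) = ∅ := by
      ext z
      simp only [Set.mem_iInter, Set.mem_Ioo, Set.mem_empty_iff_false, iff_false]
      intro hz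
      exact absurd (ge_of_tendsto' hulim fun n => (hz n).2.le) (not_le.2 (hz 0).1)
    rwa [h5, measure_empty] at h4
  obtain ⟨n, hn⟩ := ((tendsto_order.1 hlim).2 (ENNReal.ofReal η)
    (ENNReal.ofReal_pos.2 hηpos)).exists
  have h6 : μ (Set.Ico t (u n)) ≤ μ (Set.Ioo r (u n)) := by
    refine (measure_mono (t := Set.Icc t r ∪ Set.Ioo r (u n)) ?_).trans
      ((measure_union_le _ _).trans (by rw [hIcc, zero_add]))
    intro z hz
    rcases le_or_gt z r with h | h
    · exact Or.inl ⟨hz.1, h⟩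
    · exact Or.inr ⟨h, hz.2⟩
  have h7 := (huM n).2
  have h8 := h6.trans_lt hn
  rw [← ofReal_measureReal] at h8
  exact absurd ((ENNReal.ofReal_lt_ofReal_iff hηpos).1 h8) (not_lt.2 h7)

/-- The function is a uniform limit of functions constant on the cells of `exists_rounding`, with
the value at a representative `Function.invFun k (k t)` of the cell. -/
lemma IntervalControlled.measurable {μ : Measure ℝ} [IsProbabilityMeasure μ] {a : ℝ → ℝ}
    (ha : IntervalControlled μ a) : Measurable a := by
  obtain ⟨C, hC, h1, -⟩ := ha
  have H : ∀ n : ℕ, ∃ b : ℝ → ℝ, Measurable b ∧ ∀ t, |b t - a t| ≤ C * (1 / ((n : ℝ) + 1)) := by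
    intro n
    obtain ⟨k, K, J, hk, -, -, hJ, hkJ⟩ := exists_rounding μ (Nat.one_div_pos_of_nat (α := ℝ) (n := n))
    refine ⟨fun t => a (Function.invFun k (k t)), (measurable_from_nat (f := fun i => a (Function.invFun k i))).comp hk, fun t => ?_⟩
    have hr : k (Function.invFun k (k t)) = k t := Function.invFun_eq ⟨t, rfl⟩
    rcases le_total (Function.invFun k (k t)) t with h | h
    · exact (h1 _ _ h).trans (mul_le_mul_of_nonneg_left
        ((measureReal_mono (hkJ _ _ hr)).trans (hJ _)) hC.le)
    · rw [abs_sub_comm]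
      exact (h1 _ _ h).trans (mul_le_mul_of_nonneg_left
        ((measureReal_mono (hkJ _ _ hr.symm)).trans (hJ _)) hC.le)
  choose b hb hba using H
  refine measurable_of_tendsto_metrizable hb ?_
  rw [tendsto_pi_nhds]
  intro t
  rw [tendsto_iff_dist_tendsto_zero]
  refine squeeze_zero (fun _ => dist_nonneg) (fun n => hba n t) ?_
  simpa using (tendsto_one_div_add_atTop_nhds_zero_nat (𝕜 := ℝ)).const_mul C

/-! ### Empirical averages -/

lemma avg_nonneg {α : Type*} {n : ℕ} {f : α → ℝ} (v : Fin n → α) (hf : ∀ x, 0 ≤ f x) :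
    0 ≤ avg f v :=
  div_nonneg (Finset.sum_nonneg fun _ _ => hf _) (Nat.cast_nonneg n)

lemma abs_avg_sub_avg_le {α : Type*} {n : ℕ} {f g : α → ℝ} {v : Fin n → α} {B : ℝ} (hB : 0 ≤ B)
    (h : ∀ j, |f (v j) - g (v j)| ≤ B) : |avg f v - avg g v| ≤ B := by
  rcases Nat.eq_zero_or_pos n with rfl | hn
  · simpa [avg] using hB
  · have hn' : (0 : ℝ) < n := Nat.cast_pos.2 hn
    rw [avg, avg, ← sub_div, ← Finset.sum_sub_distrib, abs_div, abs_of_pos hn', div_le_iff₀ hn']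
    refine (Finset.abs_sum_le_sum_abs _ _).trans ((Finset.sum_le_sum fun j _ => h j).trans ?_)
    simp [mul_comm]

lemma avg_comp_bounded {α : Type*} {n K : ℕ} {k : α → ℕ} (hk : ∀ x, k x < K) (b : ℕ → ℝ)
    (v : Fin n → α) :
    avg (fun x => b (k x)) v
      = ∑ i ∈ Finset.range K, avg ((k ⁻¹' {i}).indicator fun _ => (1 : ℝ)) v * b i := by
  simp only [avg, div_mul_eq_mul_div, ← Finset.sum_div, Finset.sum_mul]
  rw [Finset.sum_comm]
  congr 1
  refine Finset.sum_congr rfl fun j _ => ?_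
  rw [Finset.sum_eq_single (k (v j))]
  · simp
  · intro i _ hi
    simp [Set.indicator, hi.symm]
  · intro h
    exact absurd (Finset.mem_range.2 (hk _)) h

lemma integral_comp_bounded {α : Type*} [MeasurableSpace α] (μ : Measure α) [IsFiniteMeasure μ]
    {K : ℕ} {k : α → ℕ} (mk : Measurable k) (hk : ∀ x, k x < K) (b : ℕ → ℝ) :
    ∫ x, b (k x) ∂μ = ∑ i ∈ Finset.range K, μ.real (k ⁻¹' {i}) * b i := by
  have ms : ∀ i, MeasurableSet (k ⁻¹' {i}) := fun i => mk (measurableSet_singleton i)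
  have e : ∀ x, b (k x) = ∑ i ∈ Finset.range K, (k ⁻¹' {i}).indicator (fun _ => b i) x := by
    intro x
    rw [Finset.sum_eq_single (k x)]
    · simp
    · intro i _ hi
      simp [Set.indicator, hi.symm]
    · intro h
      exact absurd (Finset.mem_range.2 (hk _)) h
  simp_rw [e]
  rw [integral_finsetSum _ fun i _ => (integrable_const _).indicator (ms i)]
  refine Finset.sum_congr rfl fun i _ => ?_
  rw [integral_indicator_const _ (ms i), smul_eq_mul]

section Sample

variable {Ω₀ Ω α : Type*} [MeasurableSpace Ω₀] [MeasurableSpace Ω] [MeasurableSpace α]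
  {P : Measure Ω₀} {Q : Measure Ω}

lemma tendsto_avg_ae {V : ℕ → Ω → α} {V' : Ω₀ → α} (hind : iIndepFun V Q)
    (hlaw : ∀ i, IdentDistrib (V i) V' Q P) {f : α → ℝ} (hf : Measurable f)
    (hi : Integrable (fun ω => f (V' ω)) P) :
    ∀ᵐ ω ∂Q, Tendsto (fun n => avg f (fun i : Fin n => V i ω)) atTop
      (𝓝 (∫ ω, f (V' ω) ∂P)) := by
  have hid : ∀ i, IdentDistrib (fun ω => f (V i ω)) (fun ω => f (V' ω)) Q P := fun i =>
    (hlaw i).comp hf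
  have h := strong_law_ae_real (fun i ω => f (V i ω)) ((hid 0).integrable_iff.2 hi)
    (fun i j hij => (hind.indepFun hij).comp hf hf) fun i => (hid i).trans (hid 0).symm
  filter_upwards [h] with ω hω
  rw [(hid 0).integral_eq] at hω
  refine hω.congr fun n => ?_
  rw [avg, Fin.sum_univ_eq_sum_range (fun i => f (V i ω))]

lemma tendsto_avg_indicator_ae [IsFiniteMeasure P] {V : ℕ → Ω → α} {V' : Ω₀ → α}
    (hV' : Measurable V') (hind : iIndepFun V Q) (hlaw : ∀ i, IdentDistrib (V i) V' Q P)
    {s : Set α} (hs : MeasurableSet s) :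
    ∀ᵐ ω ∂Q, Tendsto (fun n => avg (s.indicator fun _ => (1 : ℝ)) (fun i : Fin n => V i ω)) atTop
      (𝓝 ((P.map V').real s)) := by
  have h := tendsto_avg_ae hind hlaw (measurable_const.indicator hs : Measurable (s.indicator fun _ => (1 : ℝ)))
    ((integrable_const (1 : ℝ)).indicator (hV' hs))
  have e : ∫ ω, s.indicator (fun _ => (1 : ℝ)) (V' ω) ∂P = (P.map V').real s := by
    rw [map_measureReal_apply hV' hs, ← integral_indicator_one (hV' hs)]
    rfl
  rwa [e] at h

/-- Each point is rounded to the representative of its cell. Rounding changes the empirical average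
by at most 2Cε, as each `J i` eventually has empirical mass below 2ε, and the integral by at most
C'ε. Between the two rounded quantities only finitely many limits are involved, costing a last ε. -/
lemma eventually_abs_avg_sub_integral_le {μ : Measure ℝ} [IsProbabilityMeasure μ] {v : ℕ → ℝ}
    {a : ℕ → ℝ → ℝ} {a' : ℝ → ℝ} {C C' ε : ℝ} (hC : 0 ≤ C) (hε : 0 < ε)
    (hctrl : ∀ n s t, s ≤ t → |a n s - a n t| ≤
      C * avg ((Set.Ico s t).indicator fun _ => (1 : ℝ)) (fun i : Fin n => v i))
    (hctrl' : ∀ s t, s ≤ t → |a' s - a' t| ≤ C' * μ.real (Set.Ico s t)) (hC' : 0 ≤ C')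
    (ma' : Measurable a') (hia' : Integrable a' μ)
    {k : ℝ → ℕ} {r : ℕ → ℝ} {K : ℕ} {J : ℕ → Set ℝ} (mk : Measurable k) (hk : ∀ t : ℝ, k t < K)
    (hJ : ∀ i, μ.real (J i) ≤ ε) (hkJ : ∀ s t, k s = k t → Set.Ico s t ⊆ J (k t))
    (hr : ∀ t, k (r (k t)) = k t)
    (limJ : ∀ i, Tendsto (fun n => avg ((J i).indicator fun _ => (1 : ℝ)) (fun i : Fin n => v i))
      atTop (𝓝 (μ.real (J i))))
    (limk : ∀ i : ℕ, Tendsto (fun n => avg ((k ⁻¹' {i}).indicator fun _ => (1 : ℝ))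
      (fun i : Fin n => v i)) atTop (𝓝 (μ.real (k ⁻¹' {i}))))
    (lima : ∀ i : ℕ, Tendsto (fun n => a n (r i)) atTop (𝓝 (a' (r i)))) :
    ∀ᶠ n in atTop, |avg (a n) (fun i : Fin n => v i) - ∫ t, a' t ∂μ| ≤ (2 * C + C' + 1) * ε := by
  have h1 : ∀ᶠ n in atTop, ∀ i ∈ Finset.range K,
      avg ((J i).indicator fun _ => (1 : ℝ)) (fun i : Fin n => v i) < 2 * ε := by
    rw [Filter.eventually_all_finset]
    intro i _
    exact (tendsto_order.1 (limJ i)).2 _ (by linarith [hJ i])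
  have h2 : Tendsto (fun n => avg (fun x => a n (r (k x))) (fun i : Fin n => v i)) atTop
      (𝓝 (∫ t, a' (r (k t)) ∂μ)) := by
    rw [integral_comp_bounded μ mk hk (fun i => a' (r i))]
    have e : ∀ n, avg (fun x => a n (r (k x))) (fun i : Fin n => v i) =
      ∑ i ∈ Finset.range K, avg ((k ⁻¹' {i}).indicator fun _ => (1 : ℝ)) (fun i : Fin n => v i) *
        a n (r i) := fun n => avg_comp_bounded hk (fun i => a n (r i)) _
    simp_rw [e]
    exact tendsto_finsetSum _ fun i _ => (limk i).mul (lima i)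
  have h3 : |∫ t, a' (r (k t)) ∂μ - ∫ t, a' t ∂μ| ≤ C' * ε := by
    have hb : ∀ t, |a' (r (k t)) - a' t| ≤ C' * ε := by
      intro t
      rcases le_total (r (k t)) t with h | h
      · exact (hctrl' _ _ h).trans (mul_le_mul_of_nonneg_left
          ((measureReal_mono (hkJ _ _ (hr t))).trans (hJ _)) hC')
      · rw [abs_sub_comm]
        exact (hctrl' _ _ h).trans (mul_le_mul_of_nonneg_left
          ((measureReal_mono (hkJ _ _ (hr t).symm)).trans (hJ _)) hC')
    have hi : Integrable (fun t => a' (r (k t)) - a' t) μ :=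
      Integrable.of_bound ((((measurable_from_nat (f := fun i => a' (r i))).comp mk).sub
        ma').aestronglyMeasurable) (C' * ε) (ae_of_all _ hb)
    have hi2 : Integrable (fun t => a' (r (k t))) μ := by
      have := hi.add hia'
      refine this.congr (ae_of_all _ fun t => ?_)
      simp
    rw [← integral_sub hi2 hia']
    have := norm_integral_le_of_norm_le_const (μ := μ) (f := fun t => a' (r (k t)) - a' t)
      (C := C' * ε) (ae_of_all _ hb)
    simpa using this
  filter_upwards [h1, (Metric.tendsto_nhds.1 h2) ε hε] with n hn1 hn2
  rw [Real.dist_eq] at hn2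
  have h4 : |avg (a n) (fun i : Fin n => v i) - avg (fun x => a n (r (k x))) (fun i : Fin n => v i)|
      ≤ C * (2 * ε) := by
    refine abs_avg_sub_avg_le (by positivity) fun j => ?_
    set t := v j
    have hJt := (hn1 (k t) (Finset.mem_range.2 (hk t))).le
    have mono : ∀ s : Set ℝ, s ⊆ J (k t) →
        avg (s.indicator fun _ => (1 : ℝ)) (fun i : Fin n => v i) ≤ 2 * ε := fun s hs => by
      refine le_trans ?_ hJt
      refine div_le_div_of_nonneg_right (Finset.sum_le_sum fun j _ => ?_) (Nat.cast_nonneg n)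
      exact Set.indicator_le_indicator_of_subset hs (fun _ => zero_le_one) _
    rcases le_total (r (k t)) t with h | h
    · rw [abs_sub_comm]
      exact (hctrl n _ _ h).trans (mul_le_mul_of_nonneg_left (mono _ (hkJ _ _ (hr t))) hC)
    · have hsub := hkJ t (r (k t)) (hr t).symm
      rw [hr t] at hsub
      exact (hctrl n _ _ h).trans (mul_le_mul_of_nonneg_left (mono _ hsub) hC)
  have h5 := abs_add_three (avg (a n) (fun i : Fin n => v i) -
    avg (fun x => a n (r (k x))) (fun i : Fin n => v i))
    (avg (fun x => a n (r (k x))) (fun i : Fin n => v i) - ∫ t, a' (r (k t)) ∂μ)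
    (∫ t, a' (r (k t)) ∂μ - ∫ t, a' t ∂μ)
  rw [sub_add_sub_cancel, sub_add_sub_cancel] at h5
  linarith

lemma IntervalControlled.integrable {μ : Measure ℝ} [IsProbabilityMeasure μ] {a : ℝ → ℝ}
    (ha : IntervalControlled μ a) : Integrable a μ := by
  have hm := ha.measurable
  obtain ⟨C, hC, -, h2⟩ := ha
  refine Integrable.of_bound hm.aestronglyMeasurable C (ae_of_all _ fun t => ?_)
  exact (h2 t).trans (mul_le_of_le_one_right hC.le measureReal_le_one)

/-- If random functions have increments controlled by the empirical mass of intervals and converge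
pointwise, then their averages along the sample converge. -/
lemma tendsto_avg_of_controlled [IsProbabilityMeasure P] {V : ℕ → Ω → ℝ} {V' : Ω₀ → ℝ}
    (hV' : Measurable V') (hind : iIndepFun V Q) (hlaw : ∀ i, IdentDistrib (V i) V' Q P)
    {a : ℕ → Ω → ℝ → ℝ} {a' : ℝ → ℝ} {C : ℝ} (hC : 0 ≤ C)
    (hctrl : ∀ n ω s t, s ≤ t → |a n ω s - a n ω t| ≤
      C * avg ((Set.Ico s t).indicator fun _ => (1 : ℝ)) (fun i : Fin n => V i ω))
    (ha' : IntervalControlled (P.map V') a')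
    (hlim : ∀ t, ∀ᵐ ω ∂Q, Tendsto (fun n => a n ω t) atTop (𝓝 (a' t))) :
    ∀ᵐ ω ∂Q, Tendsto (fun n => avg (a n ω) (fun i : Fin n => V i ω)) atTop
      (𝓝 (∫ t, a' t ∂(P.map V'))) := by
  have : IsProbabilityMeasure (P.map V') := Measure.isProbabilityMeasure_map hV'.aemeasurable
  have ma' := ha'.measurable
  have ia' := ha'.integrable
  obtain ⟨C', hC', hctrl', -⟩ := ha'
  -- For each precision only countably many cells, sets `J i` and levels are used, so one null set
  -- serves all of them.
  have key : ∀ m : ℕ, ∀ᵐ ω ∂Q, ∀ᶠ n in atTop,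
      |avg (a n ω) (fun i : Fin n => V i ω) - ∫ t, a' t ∂(P.map V')|
        ≤ (2 * C + C' + 1) * (1 / ((m : ℝ) + 1)) := by
    intro m
    obtain ⟨k, K, J, mk, hk, mJ, hJ, hkJ⟩ :=
      exists_rounding (P.map V') (Nat.one_div_pos_of_nat (α := ℝ) (n := m))
    have l1 := ae_all_iff.2 fun i => tendsto_avg_indicator_ae hV' hind hlaw (mJ i)
    have l2 := ae_all_iff.2 fun i : ℕ =>
      tendsto_avg_indicator_ae hV' hind hlaw (mk (measurableSet_singleton i))
    have l3 := ae_all_iff.2 fun i : ℕ => hlim (Function.invFun k i)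
    filter_upwards [l1, l2, l3] with ω h1 h2 h3
    exact eventually_abs_avg_sub_integral_le (v := fun i => V i ω) (a := fun n => a n ω)
      (r := fun i => Function.invFun k i) hC Nat.one_div_pos_of_nat (fun n => hctrl n ω) hctrl'
      hC'.le ma' ia' mk hk hJ hkJ (fun t => Function.invFun_eq ⟨t, rfl⟩) h1 h2 h3
  filter_upwards [ae_all_iff.2 key] with ω hω
  rw [Metric.tendsto_nhds]
  intro δ hδ
  have hpos : 0 < 2 * C + C' + 1 := by linarith
  obtain ⟨m, hm⟩ := exists_nat_one_div_lt (div_pos hδ hpos)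
  filter_upwards [hω m] with n hn
  rw [Real.dist_eq]
  refine hn.trans_lt ?_
  rw [lt_div_iff₀ hpos] at hm
  linarith

end Sample

/-! ### Uniform sorting permutations -/

lemma measurableSet_monotone_comp {n : ℕ} (s : Equiv.Perm (Fin n)) :
    MeasurableSet {u : Fin n → ℝ | Monotone (u ∘ s)} := by
  have e : {u : Fin n → ℝ | Monotone (u ∘ s)} =
      ⋂ (i : Fin n) (j : Fin n) (_ : i ≤ j), {u | u (s i) ≤ u (s j)} := by
    ext u
    simp [Monotone]
  rw [e]
  exact MeasurableSet.iInter fun i => MeasurableSet.iInter fun j => MeasurableSet.iInter fun _ =>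
    measurableSet_le (measurable_pi_apply _) (measurable_pi_apply _)

lemma measurable_uniformSortProb {n : ℕ} (s : Equiv.Perm (Fin n)) :
    Measurable fun u : Fin n → ℝ => uniformSortProb u s := by
  classical
  unfold uniformSortProb
  refine Measurable.ite (measurableSet_monotone_comp s) (Measurable.inv ?_) measurable_const
  have e : ∀ u : Fin n → ℝ, (Nat.card {t : Equiv.Perm (Fin n) // Monotone (u ∘ t)} : ℝ) =
      ∑ t : Equiv.Perm (Fin n), if Monotone (u ∘ t) then 1 else 0 := by
    intro u
    rw [Finset.sum_boole, Nat.card_eq_fintype_card, Fintype.card_subtype]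
  simp_rw [e]
  exact Finset.measurable_sum _ fun t _ =>
    Measurable.ite (measurableSet_monotone_comp t) measurable_const measurable_const

lemma uniformSortProb_nonneg {n : ℕ} (u : Fin n → ℝ) (s : Equiv.Perm (Fin n)) :
    0 ≤ uniformSortProb u s := by
  unfold uniformSortProb
  split_ifs <;> positivity

lemma uniformSortProb_le_one {n : ℕ} (u : Fin n → ℝ) (s : Equiv.Perm (Fin n)) :
    uniformSortProb u s ≤ 1 := by
  unfold uniformSortProb
  split_ifs
  · exact Nat.cast_inv_le_one _
  · exact zero_le_one

lemma sum_uniformSortProb_le_one {n : ℕ} (u : Fin n → ℝ) : ∑ s, uniformSortProb u s ≤ 1 := by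
  classical
  unfold uniformSortProb
  rw [← Finset.sum_filter, Finset.sum_const, Nat.card_eq_fintype_card, Fintype.card_subtype,
    nsmul_eq_mul]
  exact mul_inv_le_one

section

variable {Ω : Type*} [MeasurableSpace Ω] {Q : Measure Ω} {n : ℕ}
  {x y : Fin n → Ω → ℝ} {σ : Ω → Equiv.Perm (Fin n)}

/-- The conditional law of σ, integrated over an event of the data. In this form σ is traded for a
weight that depends on the `x`-data alone. -/
lemma IsUniformSort.measure_inter_eq [IsProbabilityMeasure Q] (hσ : IsUniformSort Q x y σ)
    (hx : ∀ i, Measurable (x i)) (hy : ∀ i, Measurable (y i)) {B : Set (Fin n → ℝ × ℝ)}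
    (hB : MeasurableSet B) (s : Equiv.Perm (Fin n)) :
    Q ({ω | (fun i => (x i ω, y i ω)) ∈ B} ∩ {ω | σ ω = s}) =
      ∫⁻ ω in {ω | (fun i => (x i ω, y i ω)) ∈ B},
        ENNReal.ofReal (uniformSortProb (fun i => x i ω) s) ∂Q := by
  have md : Measurable fun ω i => (x i ω, y i ω) := by fun_prop
  have mx : Measurable fun ω i => x i ω := by fun_prop
  have hm := md.comap_le
  have mE := hσ.measurableSet_eq s
  set A : Set Ω := {ω | (fun i => (x i ω, y i ω)) ∈ B} with hA
  have mA : MeasurableSet[MeasurableSpace.comap (fun ω i => (x i ω, y i ω)) inferInstance] A :=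
    ⟨B, hB, rfl⟩
  have h1 := setIntegral_condExp hm (f := {ω | σ ω = s}.indicator fun _ => (1 : ℝ)) (μ := Q)
    ((integrable_const (1 : ℝ)).indicator mE) mA
  have h2 : ∫ ω in A, (Q⟦{ω | σ ω = s} |
      MeasurableSpace.comap (fun ω i => (x i ω, y i ω)) inferInstance⟧) ω ∂Q =
      ∫ ω in A, uniformSortProb (fun i => x i ω) s ∂Q :=
    integral_congr_ae (ae_restrict_of_ae (hσ.condProb_eq s))
  rw [h2, integral_indicator_const _ mE, smul_eq_mul, mul_one] at h1
  rw [measureReal_restrict_apply mE] at h1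
  have mp : Measurable fun ω => uniformSortProb (fun i => x i ω) s :=
    (measurable_uniformSortProb s).comp mx
  have hi : Integrable (fun ω => uniformSortProb (fun i => x i ω) s) (Q.restrict A) :=
    Integrable.of_bound mp.aestronglyMeasurable 1 (ae_of_all _ fun ω => by
      rw [Real.norm_eq_abs, abs_of_nonneg (uniformSortProb_nonneg _ _)]
      exact uniformSortProb_le_one _ _)
  rw [← ofReal_integral_eq_lintegral_ofReal hi (ae_of_all _ fun ω => uniformSortProb_nonneg _ _),
    h1, ofReal_measureReal, Set.inter_comm]

lemma IsUniformSort.ae_monotone [IsProbabilityMeasure Q] (hσ : IsUniformSort Q x y σ)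
    (hx : ∀ i, Measurable (x i)) (hy : ∀ i, Measurable (y i)) :
    ∀ᵐ ω ∂Q, Monotone fun i => x (σ ω i) ω := by
  have h : ∀ s : Equiv.Perm (Fin n), ∀ᵐ ω ∂Q, σ ω = s → Monotone fun i => x (s i) ω := by
    intro s
    have mB : MeasurableSet {d : Fin n → ℝ × ℝ | ¬ Monotone ((fun i => (d i).1) ∘ s)} :=
      (measurableSet_monotone_comp s).compl.preimage
        (f := fun (d : Fin n → ℝ × ℝ) i => (d i).1) (by fun_prop)
    have h1 := hσ.measure_inter_eq hx hy mB s
    have mx : Measurable fun ω i => (x i ω, y i ω) := by fun_prop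
    have mpre : MeasurableSet {ω | (fun i => (x i ω, y i ω)) ∈
      {d : Fin n → ℝ × ℝ | ¬ Monotone ((fun i => (d i).1) ∘ s)}} := mx mB
    rw [setLIntegral_congr_fun (g := fun _ => 0) mpre, lintegral_zero] at h1
    · rw [ae_iff]
      refine measure_mono_null (fun ω hω => ?_) h1
      simp only [Classical.not_imp, Set.mem_ofPred_eq] at hω
      exact ⟨hω.2, hω.1⟩
    · intro ω hω
      simp only [uniformSortProb, Set.mem_ofPred_eq] at hω ⊢
      rw [if_neg hω, ENNReal.ofReal_zero]
  filter_upwards [ae_all_iff.2 h] with ω hω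
  exact hω _ rfl

/-- The bits `t ≤ y i`. -/
def bitsOf (y : Fin n → Ω → ℝ) (t : ℝ) (ω : Ω) (i : Fin n) : Bool := decide (t ≤ y i ω)

lemma measurableSet_decide_le_eq (t : ℝ) (b : Bool) :
    MeasurableSet {v : ℝ | decide (t ≤ v) = b} := by
  cases b
  · have : {v : ℝ | decide (t ≤ v) = false} = Set.Iio t := by ext; simp
    rw [this]; exact measurableSet_Iio
  · have : {v : ℝ | decide (t ≤ v) = true} = Set.Ici t := by ext; simp
    rw [this]; exact measurableSet_Ici

/-- Given the `x`-data, the bits are independent. -/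
lemma lintegral_bitsOf_eq [IsProbabilityMeasure Q] (hx : ∀ i, Measurable (x i))
    (hind : iIndepFun (fun i ω => (x i ω, y i ω)) Q)
    {t : ℝ} {g : ℝ → ℝ} (mg : Measurable g) (hg01 : ∀ u, g u ∈ Set.Icc (0 : ℝ) 1)
    (hg : ∀ i (b : Bool) (A : Set ℝ), MeasurableSet A →
      Q (x i ⁻¹' A ∩ {ω | decide (t ≤ y i ω) = b}) =
        ∫⁻ ω in x i ⁻¹' A, ENNReal.ofReal (bitProb (g (x i ω)) b) ∂Q)
    (c : Fin n → Bool) {h : (Fin n → ℝ) → ENNReal} (mh : Measurable h) :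
    ∫⁻ ω in {ω | bitsOf y t ω = c}, h (fun i => x i ω) ∂Q =
      ∫⁻ ω, ENNReal.ofReal (∏ i, bitProb (g (x i ω)) (c i)) * h (fun i => x i ω) ∂Q := by
  have mx : Measurable fun ω i => x i ω := by fun_prop
  have mw : ∀ b, Measurable fun u => ENNReal.ofReal (bitProb (g u) b) := by
    intro b
    cases b
    · exact (measurable_const.sub mg).ennreal_ofReal
    · exact mg.ennreal_ofReal
  set w : Ω → ENNReal := fun ω => ∏ i, ENNReal.ofReal (bitProb (g (x i ω)) (c i)) with hw
  have mwΩ : Measurable w := Finset.measurable_prod _ fun i _ => (mw (c i)).comp (hx i)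
  have hwe : ∀ ω, ENNReal.ofReal (∏ i, bitProb (g (x i ω)) (c i)) = w ω := fun ω =>
    ENNReal.ofReal_prod_of_nonneg fun i _ => bitProb_nonneg (hg01 _) _
  set ρ : Fin n → Measure ℝ := fun i =>
    (Q.restrict {ω | decide (t ≤ y i ω) = c i}).map (x i) with hρ
  have hρa : ∀ i A, MeasurableSet A → ρ i A = Q (x i ⁻¹' A ∩ {ω | decide (t ≤ y i ω) = c i}) := by
    intro i A hA
    rw [hρ, Measure.map_apply (hx i) hA, Measure.restrict_apply (hx i hA)]
  have : ∀ i, IsFiniteMeasure (ρ i) := fun i => by rw [hρ]; infer_instance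
  -- The product of the `ρ i` is computed twice: from independence of the pairs it is the law of the
  -- `x`-data on the event that the bits equal `c`; from `hg` it is the law of the `x`-data weighted
  -- by the product of bit probabilities.
  have e1 : Measure.pi ρ = (Q.restrict {ω | bitsOf y t ω = c}).map fun ω i => x i ω := by
    refine Measure.pi_eq fun A hA => ?_
    rw [Measure.map_apply mx (MeasurableSet.univ_pi hA),
      Measure.restrict_apply (mx (MeasurableSet.univ_pi hA))]
    have h1 := hind.measure_inter_preimage_eq_mul Finset.univ
      (sets := fun i => A i ×ˢ {v | decide (t ≤ v) = c i})
      (fun i _ => (hA i).prod (measurableSet_decide_le_eq t _))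
    have h2 : (fun ω i => x i ω) ⁻¹' Set.univ.pi A ∩ {ω | bitsOf y t ω = c} =
        ⋂ i ∈ Finset.univ, (fun ω => (x i ω, y i ω)) ⁻¹' (A i ×ˢ {v | decide (t ≤ v) = c i}) := by
      ext ω
      simp [bitsOf, funext_iff, forall_and]
    rw [h2, h1]
    refine Finset.prod_congr rfl fun i _ => ?_
    rw [hρa i _ (hA i)]
    rfl
  have e2 : Measure.pi ρ = (Q.withDensity w).map fun ω i => x i ω := by
    refine Measure.pi_eq fun A hA => ?_
    have mpre := mx (MeasurableSet.univ_pi hA)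
    rw [Measure.map_apply mx (MeasurableSet.univ_pi hA), withDensity_apply _ mpre,
      ← lintegral_indicator mpre]
    set X : Fin n → Ω → ENNReal := fun i ω =>
      (A i).indicator (fun u => ENNReal.ofReal (bitProb (g u) (c i))) (x i ω) with hX
    have mX : ∀ i, Measurable (X i) := fun i => ((mw (c i)).indicator (hA i)).comp (hx i)
    have hXi : iIndepFun X Q := hind.comp
      (fun i d => (A i).indicator (fun u => ENNReal.ofReal (bitProb (g u) (c i))) d.1)
      fun i => ((mw (c i)).indicator (hA i)).comp measurable_fst
    have h1 := lintegral_prod_eq_prod_lintegral_of_indepFun Finset.univ X hXi mX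
    have h2 : ∀ ω, ((fun ω i => x i ω) ⁻¹' Set.univ.pi A).indicator w ω = ∏ i, X i ω := by
      intro ω
      by_cases hω : ω ∈ (fun ω i => x i ω) ⁻¹' Set.univ.pi A
      · rw [Set.indicator_of_mem hω]
        refine Finset.prod_congr rfl fun i _ => ?_
        exact (Set.indicator_of_mem (show x i ω ∈ A i from hω i (Set.mem_univ i)) (fun u => ENNReal.ofReal (bitProb (g u) (c i)))).symm
      · rw [Set.indicator_of_notMem hω]
        simp only [Set.mem_preimage, Set.mem_univ_pi, not_forall] at hω
        obtain ⟨i, hi⟩ := hω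
        have h0 : X i ω = 0 := Set.indicator_of_notMem hi _
        symm
        exact Finset.prod_eq_zero (Finset.mem_univ i) h0
    simp_rw [h2]
    rw [h1]
    refine Finset.prod_congr rfl fun i _ => ?_
    rw [hρa i _ (hA i), hg i (c i) (A i) (hA i), ← lintegral_indicator (hx i (hA i))]
    rfl
  simp_rw [hwe]
  rw [← lintegral_map (μ := Q.restrict {ω | bitsOf y t ω = c}) (f := h) mh mx, ← e1, e2,
    lintegral_map mh mx]
  exact lintegral_withDensity_eq_lintegral_mul Q mwΩ (mh.comp mx)

lemma jumps_comp_perm_eq (v : Fin n → ℝ) (t : ℝ) (s : Equiv.Perm (Fin n)) :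
    jumps (v ∘ s) t = bitChanges ((fun i => decide (t ≤ v i)) ∘ s) := by
  have e : ∀ w : ℝ, geInd t w = bitVal (decide (t ≤ w)) := by
    intro w
    by_cases h : t ≤ w <;> simp [geInd, bitVal, h]
  simp only [jumps, bitChanges, e, Function.comp]

/-- Concentration of the number of threshold crossings along the sorted sample. -/
lemma IsUniformSort.measure_jumps_deviation_le [IsProbabilityMeasure Q]
    (hσ : IsUniformSort Q x y σ) (hx : ∀ i, Measurable (x i))
    (hy : ∀ i, Measurable (y i)) (hind : iIndepFun (fun i ω => (x i ω, y i ω)) Q)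
    {t : ℝ} {g : ℝ → ℝ} (mg : Measurable g) (hg01 : ∀ u, g u ∈ Set.Icc (0 : ℝ) 1)
    (hg : ∀ i (b : Bool) (A : Set ℝ), MeasurableSet A →
      Q (x i ⁻¹' A ∩ {ω | decide (t ≤ y i ω) = b}) =
        ∫⁻ ω in x i ⁻¹' A, ENNReal.ofReal (bitProb (g (x i ω)) b) ∂Q)
    {ε : ℝ} (h0 : 0 ≤ ε) (h1 : ε ≤ 1) :
    Q {ω | n * ε ≤ |jumps ((fun i => y i ω) ∘ σ ω) t - meanChanges fun i => g (x (σ ω i) ω)|}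
      ≤ ENNReal.ofReal (2 * Real.exp (-(ε ^ 2 / 16)) ^ n) := by
  classical
  have mx : Measurable fun ω i => x i ω := by fun_prop
  set Bad : Equiv.Perm (Fin n) → (Fin n → Bool) → Set (Fin n → ℝ) := fun s c =>
    {u | n * ε ≤ |bitChanges (c ∘ s) - meanChanges fun i => g (u (s i))|} with hBad
  have mBad : ∀ s c, MeasurableSet (Bad s c) := by
    intro s c
    have : Measurable fun u : Fin n → ℝ => meanChanges fun i => g (u (s i)) := by
      unfold meanChanges; fun_prop
    exact measurableSet_le measurable_const (measurable_const.sub this).abs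
  have hbit : ∀ (c : Fin n → Bool), MeasurableSet {d : Fin n → ℝ × ℝ | ∀ i, decide (t ≤ (d i).2) = c i} := by
    intro c
    simp only [Set.ofPred_forall]
    exact MeasurableSet.iInter fun i =>
      (measurableSet_decide_le_eq t (c i)).preimage (f := fun d : Fin n → ℝ × ℝ => (d i).2)
        (by fun_prop)
  -- With σ = s and bits = c fixed, the deviation is an event of the `x`-data. First σ is integrated
  -- out given all the data, then the bits given the `x`-data.
  have step : ∀ s c, Q ({ω | bitsOf y t ω = c} ∩ {ω | (fun i => x i ω) ∈ Bad s c} ∩ {ω | σ ω = s}) =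
      ∫⁻ ω, ENNReal.ofReal (∏ i, bitProb (g (x i ω)) (c i)) *
        (Bad s c).indicator (fun u => ENNReal.ofReal (uniformSortProb u s)) (fun i => x i ω) ∂Q := by
    intro s c
    have hB := (hbit c).inter ((mBad s c).preimage
      (f := fun (d : Fin n → ℝ × ℝ) i => (d i).1) (by fun_prop))
    have e := hσ.measure_inter_eq hx hy hB s
    have e3 : {ω | (fun i => (x i ω, y i ω)) ∈ {d : Fin n → ℝ × ℝ | ∀ i, decide (t ≤ (d i).2) = c i} ∩
        (fun (d : Fin n → ℝ × ℝ) i => (d i).1) ⁻¹' (Bad s c)} =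
        {ω | bitsOf y t ω = c} ∩ {ω | (fun i => x i ω) ∈ Bad s c} := by
      ext ω
      simp [bitsOf, funext_iff]
    rw [e3] at e
    have mpre : MeasurableSet {ω | (fun i => x i ω) ∈ Bad s c} := mx (mBad s c)
    rw [e, Set.inter_comm, ← Measure.restrict_restrict mpre, ← lintegral_indicator mpre]
    rw [← lintegral_bitsOf_eq hx hind mg hg01 hg c
      ((measurable_uniformSortProb s).ennreal_ofReal.indicator (mBad s c))]
    rfl
  have hsub : {ω | n * ε ≤ |jumps ((fun i => y i ω) ∘ σ ω) t - meanChanges fun i => g (x (σ ω i) ω)|}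
      ⊆ ⋃ s ∈ (Finset.univ : Finset (Equiv.Perm (Fin n))), ⋃ c ∈ (Finset.univ : Finset (Fin n → Bool)),
        ({ω | bitsOf y t ω = c} ∩ {ω | (fun i => x i ω) ∈ Bad s c} ∩ {ω | σ ω = s}) := by
    intro ω hω
    simp only [Set.mem_iUnion]
    refine ⟨σ ω, Finset.mem_univ _, bitsOf y t ω, Finset.mem_univ _, ⟨rfl, ?_⟩, rfl⟩
    rw [Set.mem_ofPred_eq, jumps_comp_perm_eq] at hω
    exact hω
  refine (measure_mono hsub).trans ((measure_biUnion_finset_le _ _).trans ?_)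
  refine (Finset.sum_le_sum fun s _ => measure_biUnion_finset_le _ _).trans ?_
  simp_rw [step]
  have mint : ∀ s c, Measurable fun ω => ENNReal.ofReal (∏ i, bitProb (g (x i ω)) (c i)) *
      (Bad s c).indicator (fun u => ENNReal.ofReal (uniformSortProb u s)) (fun i => x i ω) := by
    intro s c
    refine Measurable.mul (Measurable.ennreal_ofReal (Finset.measurable_prod _ fun i _ => ?_))
      (((measurable_uniformSortProb s).ennreal_ofReal.indicator (mBad s c)).comp mx)
    cases c i
    · exact measurable_const.sub (mg.comp (hx i))
    · exact mg.comp (hx i)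
  have e4 : ∀ s, ∑ c, ∫⁻ ω, ENNReal.ofReal (∏ i, bitProb (g (x i ω)) (c i)) *
      (Bad s c).indicator (fun u => ENNReal.ofReal (uniformSortProb u s)) (fun i => x i ω) ∂Q =
      ∫⁻ ω, ∑ c, ENNReal.ofReal (∏ i, bitProb (g (x i ω)) (c i)) *
      (Bad s c).indicator (fun u => ENNReal.ofReal (uniformSortProb u s)) (fun i => x i ω) ∂Q :=
    fun s => (lintegral_finsetSum _ fun c _ => mint s c).symm
  simp_rw [e4]
  rw [← lintegral_finsetSum _ fun s _ => Finset.measurable_sum _ fun c _ => mint s c]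
  set δ : ℝ := 2 * Real.exp (-(ε ^ 2 / 16)) ^ n with hδ
  have hδ0 : 0 ≤ δ := by positivity
  have bound : ∀ ω, ∑ s, ∑ c, ENNReal.ofReal (∏ i, bitProb (g (x i ω)) (c i)) *
      (Bad s c).indicator (fun u => ENNReal.ofReal (uniformSortProb u s)) (fun i => x i ω)
      ≤ ENNReal.ofReal δ := by
    intro ω
    set u : Fin n → ℝ := fun i => x i ω with hu
    have hprod : ∀ c : Fin n → Bool, 0 ≤ ∏ i, bitProb (g (u i)) (c i) := fun c =>
      Finset.prod_nonneg fun i _ => bitProb_nonneg (hg01 _) _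
    have e5 : ∀ s c, ENNReal.ofReal (∏ i, bitProb (g (u i)) (c i)) *
        (Bad s c).indicator (fun u => ENNReal.ofReal (uniformSortProb u s)) u =
        ENNReal.ofReal (uniformSortProb u s * ((∏ i, bitProb (g (u i)) (c i)) *
          (if n * ε ≤ |bitChanges (c ∘ s) - meanChanges fun i => g (u (s i))| then 1 else 0))) := by
      intro s c
      by_cases h : u ∈ Bad s c
      · rw [Set.indicator_of_mem h, if_pos (show n * ε ≤ _ from h), mul_one, mul_comm (uniformSortProb u s),
          ENNReal.ofReal_mul (hprod c)]
      · rw [Set.indicator_of_notMem h, if_neg (show ¬ n * ε ≤ _ from h)]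
        simp
    have hnn : ∀ s c, 0 ≤ uniformSortProb u s * ((∏ i, bitProb (g (u i)) (c i)) *
          (if n * ε ≤ |bitChanges (c ∘ s) - meanChanges fun i => g (u (s i))| then 1 else 0)) := by
      intro s c
      refine mul_nonneg (uniformSortProb_nonneg _ _) (mul_nonneg (hprod c) ?_)
      split_ifs <;> norm_num
    have e6 : ∑ s, ∑ c, ENNReal.ofReal (∏ i, bitProb (g (u i)) (c i)) *
        (Bad s c).indicator (fun u => ENNReal.ofReal (uniformSortProb u s)) u =
        ENNReal.ofReal (∑ s, ∑ c, uniformSortProb u s * ((∏ i, bitProb (g (u i)) (c i)) *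
          (if n * ε ≤ |bitChanges (c ∘ s) - meanChanges fun i => g (u (s i))| then 1 else 0))) := by
      rw [ENNReal.ofReal_sum_of_nonneg fun s _ => Finset.sum_nonneg fun c _ => hnn s c]
      refine Finset.sum_congr rfl fun s _ => ?_
      rw [ENNReal.ofReal_sum_of_nonneg fun c _ => hnn s c]
      exact Finset.sum_congr rfl fun c _ => e5 s c
    rw [e6]
    refine ENNReal.ofReal_le_ofReal ?_
    -- Permuting independent bits together with their probabilities changes nothing, so the bound is
    -- the same for every `s`. It is then averaged with weights of total at most 1, so no factor n!
    -- is paid.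
    have e7 : ∀ s : Equiv.Perm (Fin n), ∑ c : Fin n → Bool, (∏ i, bitProb (g (u i)) (c i)) *
          (if n * ε ≤ |bitChanges (c ∘ s) - meanChanges fun i => g (u (s i))| then 1 else 0) ≤ δ := by
      intro s
      refine le_trans (le_of_eq ?_) (sum_prod_bitProb_bitChanges_le (fun i => g (u (s i)))
        (fun i => hg01 _) h0 h1)
      refine Fintype.sum_equiv (Equiv.arrowCongr s.symm (Equiv.refl Bool)) _ _ fun c => ?_
      have e8 : (Equiv.arrowCongr s.symm (Equiv.refl Bool)) c = c ∘ s := by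
        ext i; simp [Equiv.arrowCongr]
      rw [e8, ← Equiv.prod_comp s]
      rfl
    calc _ = ∑ s, uniformSortProb u s * ∑ c : Fin n → Bool, (∏ i, bitProb (g (u i)) (c i)) *
          (if n * ε ≤ |bitChanges (c ∘ s) - meanChanges fun i => g (u (s i))| then 1 else 0) := by
          simp_rw [Finset.mul_sum]
      _ ≤ ∑ s, uniformSortProb u s * δ := Finset.sum_le_sum fun s _ =>
          mul_le_mul_of_nonneg_left (e7 s) (uniformSortProb_nonneg _ _)
      _ ≤ δ := by
          rw [← Finset.sum_mul]
          exact mul_le_of_le_one_left hδ0 (sum_uniformSortProb_le_one u)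
  refine (lintegral_mono bound).trans ?_
  simp

end

/-! ### Limits along the sorted sample -/

lemma sum_sub_one_le_sum_adjacent {n : ℕ} (f : Fin n → ℝ) (hf : ∀ i, f i ≤ 1) :
    ∑ i, f i - 1 ≤ ∑ i : Fin (n - 1), f ⟨i.val, by omega⟩ ∧
      ∑ i, f i - 1 ≤ ∑ i : Fin (n - 1), f ⟨i.val + 1, by omega⟩ := by
  cases n with
  | zero => simp
  | succ m =>
    constructor
    · rw [Fin.sum_univ_castSucc, sub_le_iff_le_add]
      exact add_le_add le_rfl (hf _)
    · rw [Fin.sum_univ_succ, sub_le_iff_le_add, add_comm]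
      exact add_le_add le_rfl (hf _)

/-- Neighbouring probabilities satisfy p + q - 2pq = p(1 - p) + q(1 - q) + (p - q)², and (p - q)² ≤
|p - q|. The 2 accounts for the end terms missing from the two sums over adjacent pairs. -/
lemma abs_meanChanges_sub_le {n : ℕ} (p : Fin n → ℝ) (hp : ∀ i, p i ∈ Set.Icc (0 : ℝ) 1) :
    |meanChanges p - 2 * ∑ i, p i * (1 - p i)| ≤
      2 + ∑ i : Fin (n - 1), |p ⟨i.val + 1, by omega⟩ - p ⟨i.val, by omega⟩| := by
  have q0 : ∀ i, 0 ≤ p i * (1 - p i) := fun i => mul_nonneg (hp i).1 (sub_nonneg.2 (hp i).2)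
  have q1 : ∀ i, p i * (1 - p i) ≤ 1 := fun i => by nlinarith [(hp i).1, (hp i).2]
  obtain ⟨a1, a2⟩ := sum_adjacent_le (fun i => p i * (1 - p i)) q0
  obtain ⟨b1, b2⟩ := sum_sub_one_le_sum_adjacent (fun i => p i * (1 - p i)) q1
  have e : meanChanges p = ∑ i : Fin (n - 1), p ⟨i.val, by omega⟩ * (1 - p ⟨i.val, by omega⟩) +
      ∑ i : Fin (n - 1), p ⟨i.val + 1, by omega⟩ * (1 - p ⟨i.val + 1, by omega⟩) +
      ∑ i : Fin (n - 1), (p ⟨i.val + 1, by omega⟩ - p ⟨i.val, by omega⟩) ^ 2 := by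
    rw [meanChanges, ← Finset.sum_add_distrib, ← Finset.sum_add_distrib]
    exact Finset.sum_congr rfl fun i _ => by ring
  have s0 : 0 ≤ ∑ i : Fin (n - 1), (p ⟨i.val + 1, by omega⟩ - p ⟨i.val, by omega⟩) ^ 2 :=
    Finset.sum_nonneg fun i _ => sq_nonneg _
  have s1 : ∑ i : Fin (n - 1), (p ⟨i.val + 1, by omega⟩ - p ⟨i.val, by omega⟩) ^ 2 ≤
      ∑ i : Fin (n - 1), |p ⟨i.val + 1, by omega⟩ - p ⟨i.val, by omega⟩| := by
    refine Finset.sum_le_sum fun i _ => ?_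
    rw [← sq_abs]
    have h1 : |p ⟨i.val + 1, by omega⟩ - p ⟨i.val, by omega⟩| ≤ 1 := by
      rw [abs_le]
      constructor <;> linarith [(hp ⟨i.val, by omega⟩).1, (hp ⟨i.val, by omega⟩).2,
        (hp ⟨i.val + 1, by omega⟩).1, (hp ⟨i.val + 1, by omega⟩).2]
    exact pow_le_of_le_one (abs_nonneg _) h1 two_ne_zero
  rw [e, abs_le]
  constructor <;> linarith

lemma sum_abs_adjacent_le {n : ℕ} (p q : Fin n → ℝ) :
    ∑ i : Fin (n - 1), |p ⟨i.val + 1, by omega⟩ - p ⟨i.val, by omega⟩| ≤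
      ∑ i : Fin (n - 1), |q ⟨i.val + 1, by omega⟩ - q ⟨i.val, by omega⟩| +
        2 * ∑ i, |p i - q i| := by
  obtain ⟨h1, h2⟩ := sum_adjacent_le (fun i => |p i - q i|) fun i => abs_nonneg _
  rw [two_mul]
  refine le_trans ?_ (add_le_add le_rfl (add_le_add h1 h2))
  rw [← Finset.sum_add_distrib, ← Finset.sum_add_distrib]
  refine Finset.sum_le_sum fun i _ => ?_
  have e : p ⟨i.val + 1, by omega⟩ - p ⟨i.val, by omega⟩ =
    (q ⟨i.val + 1, by omega⟩ - q ⟨i.val, by omega⟩) + -(p ⟨i.val, by omega⟩ - q ⟨i.val, by omega⟩) +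
      (p ⟨i.val + 1, by omega⟩ - q ⟨i.val + 1, by omega⟩) := by ring
  rw [e]
  refine (abs_add_three _ _ _).trans (le_of_eq ?_)
  rw [abs_neg]
  ring

lemma avg_comp_perm {α : Type*} {n : ℕ} (f : α → ℝ) (v : Fin n → α) (s : Equiv.Perm (Fin n)) :
    avg f (v ∘ s) = avg f v := by
  unfold avg
  congr 1
  exact Equiv.sum_comp s (fun i => f (v i))

section

variable {Ω₀ Ω : Type*} [MeasurableSpace Ω₀] [MeasurableSpace Ω]
  {P : Measure Ω₀} {Q : Measure Ω} [IsProbabilityMeasure P]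

/-- Choose h of bounded variation within ε of g in L¹. Along the sorted sample h varies by at most a
constant C, and replacing g by h costs twice the empirical L¹ distance, eventually below 4εn. With
(2 + C)/n < ε the total error is at most 5ε. Ties are harmless, since monotonicity alone is used. -/
lemma tendsto_meanChanges_ae {U : ℕ → Ω → ℝ} {U' : Ω₀ → ℝ} (hU' : Measurable U')
    (hind : iIndepFun U Q) (hlaw : ∀ i, IdentDistrib (U i) U' Q P)
    {σ : (n : ℕ) → Ω → Equiv.Perm (Fin n)}
    (hσ : ∀ n, ∀ᵐ ω ∂Q, Monotone fun i : Fin n => U (σ n ω i) ω)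
    {g : ℝ → ℝ} (mg : Measurable g) (hg01 : ∀ u, g u ∈ Set.Icc (0 : ℝ) 1) :
    ∀ᵐ ω ∂Q, Tendsto (fun n => (meanChanges fun i : Fin n => g (U (σ n ω i) ω)) / n) atTop
      (𝓝 (2 * ∫ ω, g (U' ω) * (1 - g (U' ω)) ∂P)) := by
  have : IsProbabilityMeasure (P.map U') := Measure.isProbabilityMeasure_map hU'.aemeasurable
  have hgi : Integrable g (P.map U') := Integrable.of_bound mg.aestronglyMeasurable 1
    (ae_of_all _ fun u => by rw [Real.norm_eq_abs, abs_of_nonneg (hg01 u).1]; exact (hg01 u).2)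
  have mq : Measurable fun u => g u * (1 - g u) := mg.mul (measurable_const.sub mg)
  have hq : ∀ᵐ ω ∂Q, Tendsto (fun n => avg (fun u => g u * (1 - g u)) (fun i : Fin n => U i ω)) atTop
      (𝓝 (∫ ω, g (U' ω) * (1 - g (U' ω)) ∂P)) := by
    refine tendsto_avg_ae hind hlaw mq ?_
    refine Integrable.of_bound (mq.comp hU').aestronglyMeasurable 1 (ae_of_all _ fun ω => ?_)
    have h := hg01 (U' ω)
    rw [Real.norm_eq_abs, abs_of_nonneg (mul_nonneg h.1 (sub_nonneg.2 h.2))]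
    nlinarith [h.1, h.2]
  have key : ∀ m : ℕ, ∀ᵐ ω ∂Q, ∀ᶠ n : ℕ in atTop,
      |(meanChanges fun i : Fin n => g (U (σ n ω i) ω)) / n -
        2 * avg (fun u => g u * (1 - g u)) (fun i : Fin n => U i ω)| ≤ 5 * (1 / ((m : ℝ) + 1)) := by
    intro m
    set ε : ℝ := 1 / ((m : ℝ) + 1) with hε
    have hεpos : 0 < ε := Nat.one_div_pos_of_nat
    obtain ⟨h, ⟨mh, C, hC⟩, hi, hle⟩ := exists_hasBoundedVar_integral_abs_sub_le (P.map U') hgi hεpos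
    have mgh : Measurable fun u => |g u - h u| := (mg.sub mh).abs
    have l1 := tendsto_avg_ae hind hlaw mgh (hi.comp_measurable hU')
    rw [← integral_map hU'.aemeasurable mgh.aestronglyMeasurable] at l1
    have l2 : Tendsto (fun n : ℕ => (2 + C) / (n : ℝ)) atTop (𝓝 0) :=
      tendsto_const_div_atTop_nhds_zero_nat _
    filter_upwards [l1, ae_all_iff.2 hσ] with ω h1 h2
    filter_upwards [(tendsto_order.1 h1).2 (2 * ε) (by linarith), (tendsto_order.1 l2).2 ε hεpos,
      eventually_gt_atTop 0] with n hn1 hn2 hn0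
    have hn0' : (0 : ℝ) < n := Nat.cast_pos.2 hn0
    have e1 := abs_meanChanges_sub_le (fun i : Fin n => g (U (σ n ω i) ω)) fun i => hg01 _
    have e2 := sum_abs_adjacent_le (fun i : Fin n => g (U (σ n ω i) ω))
      (fun i : Fin n => h (U (σ n ω i) ω))
    have e3 := hC n _ (h2 n)
    have e4 := avg_comp_perm (fun u => g u * (1 - g u)) (fun i : Fin n => U i ω) (σ n ω)
    have e5 := avg_comp_perm (fun u => |g u - h u|) (fun i : Fin n => U i ω) (σ n ω)
    rw [← e5] at hn1
    rw [← e4]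
    simp only [avg, Function.comp] at hn1 ⊢
    rw [div_lt_iff₀ hn0'] at hn1 hn2
    rw [mul_div_assoc', ← sub_div, abs_div, abs_of_pos hn0', div_le_iff₀ hn0']
    linarith
  filter_upwards [hq, ae_all_iff.2 key] with ω h1 h2
  have h3 : Tendsto (fun n : ℕ => (meanChanges fun i : Fin n => g (U (σ n ω i) ω)) / n -
        2 * avg (fun u => g u * (1 - g u)) (fun i : Fin n => U i ω)) atTop (𝓝 0) := by
    rw [Metric.tendsto_nhds]
    intro δ hδ
    obtain ⟨m, hm⟩ := exists_nat_one_div_lt (div_pos hδ (show (0 : ℝ) < 5 by norm_num))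
    filter_upwards [h2 m] with n hn
    rw [Real.dist_eq, sub_zero]
    linarith
  have h4 := h3.add (h1.const_mul 2)
  simpa using h4

lemma measure_inter_decide_eq {U' V' : Ω₀ → ℝ} (hU' : Measurable U') (hV' : Measurable V')
    (t : ℝ) (b : Bool) {A : Set ℝ} (hA : MeasurableSet A) :
    P (U' ⁻¹' A ∩ {ω | decide (t ≤ V' ω) = b}) = ∫⁻ ω in U' ⁻¹' A,
      ENNReal.ofReal (bitProb ((condDistrib V' U' P (U' ω)).real (Set.Ici t)) b) ∂P := by
  have h := setLIntegral_preimage_condDistrib (μ := P) hU' hV'.aemeasurable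
    (measurableSet_decide_le_eq t b) hA
  have e : {ω | decide (t ≤ V' ω) = b} = V' ⁻¹' {v | decide (t ≤ v) = b} := rfl
  rw [e, ← h]
  refine lintegral_congr fun ω => ?_
  cases b
  · have e1 : {v : ℝ | decide (t ≤ v) = false} = (Set.Ici t)ᶜ := by ext; simp
    rw [e1, bitProb, cond_false, ← probReal_compl_eq_one_sub measurableSet_Ici, ofReal_measureReal]
  · have e1 : {v : ℝ | decide (t ≤ v) = true} = Set.Ici t := by ext; simp
    rw [e1, bitProb, cond_true, ofReal_measureReal]

/-- The frequency of crossings of a fixed threshold along the sorted sample. -/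
lemma tendsto_jumps_ae [IsProbabilityMeasure Q] {U V : ℕ → Ω → ℝ} {U' V' : Ω₀ → ℝ}
    (hU : ∀ i, Measurable (U i)) (hV : ∀ i, Measurable (V i))
    (hU' : Measurable U') (hV' : Measurable V')
    (hind : iIndepFun (fun i ω => (U i ω, V i ω)) Q)
    (hlaw : ∀ i, IdentDistrib (fun ω => (U i ω, V i ω)) (fun ω => (U' ω, V' ω)) Q P)
    {σ : (n : ℕ) → Ω → Equiv.Perm (Fin n)}
    (hσ : ∀ n, IsUniformSort Q (fun (i : Fin n) => U i) (fun (i : Fin n) => V i) (σ n)) (t : ℝ) :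
    ∀ᵐ ω ∂Q, Tendsto (fun n => jumps ((fun i : Fin n => V i ω) ∘ σ n ω) t / n) atTop
      (𝓝 (2 * ∫ ω, (condDistrib V' U' P (U' ω)).real (Set.Ici t) *
        (1 - (condDistrib V' U' P (U' ω)).real (Set.Ici t)) ∂P)) := by
  set g : ℝ → ℝ := fun u => (condDistrib V' U' P u).real (Set.Ici t) with hgdef
  have mg : Measurable g := (Kernel.measurable_coe _ measurableSet_Ici).ennreal_toReal
  have hg01 : ∀ u, g u ∈ Set.Icc (0 : ℝ) 1 := fun u => ⟨measureReal_nonneg, measureReal_le_one⟩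
  have hg : ∀ (i : ℕ) (b : Bool) (A : Set ℝ), MeasurableSet A →
      Q (U i ⁻¹' A ∩ {ω | decide (t ≤ V i ω) = b}) =
        ∫⁻ ω in U i ⁻¹' A, ENNReal.ofReal (bitProb (g (U i ω)) b) ∂Q := by
    intro i b A hA
    have h1 := (hlaw i).measure_mem_eq (hA.prod (measurableSet_decide_le_eq t b))
    have h2 := measure_inter_decide_eq (P := P) hU' hV' t b hA
    have m1 : Measurable fun u => A.indicator (fun u => ENNReal.ofReal (bitProb (g u) b)) u := by
      refine Measurable.indicator ?_ hA
      cases b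
      · exact (measurable_const.sub mg).ennreal_ofReal
      · exact mg.ennreal_ofReal
    have h3 := ((hlaw i).comp measurable_fst).comp m1
    have h4 := h3.lintegral_eq
    rw [← lintegral_indicator (hU i hA)]
    rw [← lintegral_indicator (hU' hA)] at h2
    exact h1.trans (h2.trans h4.symm)
  have hindn : ∀ n, iIndepFun (fun (i : Fin n) ω => (U i ω, V i ω)) Q := fun n =>
    hind.precomp Fin.val_injective
  have l1 := tendsto_meanChanges_ae hU' (hind.comp (fun _ => Prod.fst) fun _ => measurable_fst)
    (fun i => (hlaw i).comp measurable_fst)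
    (fun n => (hσ n).ae_monotone (fun i => hU i) fun i => hV i) mg hg01
  have key : ∀ m : ℕ, ∀ᵐ ω ∂Q, ∀ᶠ n : ℕ in atTop,
      |jumps ((fun i : Fin n => V i ω) ∘ σ n ω) t - meanChanges fun i : Fin n => g (U (σ n ω i) ω)|
        < n * (1 / ((m : ℝ) + 1)) := by
    intro m
    set ε : ℝ := 1 / ((m : ℝ) + 1) with hε
    have hεpos : 0 < ε := Nat.one_div_pos_of_nat
    have hε1 : ε ≤ 1 := by
      rw [hε, div_le_one (by positivity)]
      linarith [(Nat.cast_nonneg m : (0 : ℝ) ≤ m)]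
    have hb : ∀ n, _ := fun n => (hσ n).measure_jumps_deviation_le (fun i => hU i) (fun i => hV i)
      (hindn n) mg hg01 (fun i => hg i) hεpos.le hε1
    have hr : Real.exp (-(ε ^ 2 / 16)) < 1 := by
      rw [Real.exp_lt_one_iff]
      have : 0 < ε ^ 2 / 16 := by positivity
      linarith
    have hs : Summable fun n : ℕ => 2 * Real.exp (-(ε ^ 2 / 16)) ^ n :=
      (summable_geometric_of_lt_one (Real.exp_pos _).le hr).mul_left 2
    -- Borel-Cantelli: the deviation probabilities are dominated by a convergent geometric series.
    have hne := ne_top_of_le_ne_top hs.tsum_ofReal_ne_top (ENNReal.tsum_le_tsum hb)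
    filter_upwards [ae_eventually_notMem hne] with ω hω
    filter_upwards [hω] with n hn
    exact not_le.1 hn
  filter_upwards [l1, ae_all_iff.2 key] with ω h1 h2
  have h3 : Tendsto (fun n : ℕ => jumps ((fun i : Fin n => V i ω) ∘ σ n ω) t / n -
      (meanChanges fun i : Fin n => g (U (σ n ω i) ω)) / n) atTop (𝓝 0) := by
    rw [Metric.tendsto_nhds]
    intro δ hδ
    obtain ⟨m, hm⟩ := exists_nat_one_div_lt hδ
    filter_upwards [h2 m, eventually_gt_atTop 0] with n hn hn0
    have hn0' : (0 : ℝ) < n := Nat.cast_pos.2 hn0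
    rw [Real.dist_eq, sub_zero, ← sub_div, abs_div, abs_of_pos hn0', div_lt_iff₀ hn0', mul_comm]
    exact hn.trans (mul_lt_mul_of_pos_left hm hn0')
  simpa using h3.add h1

end

/-! ### Conditional probabilities of threshold events -/

section

variable {Ω : Type*} {m m₀ : MeasurableSpace Ω} {P : Measure Ω}

lemma condProb_mem_Icc [IsFiniteMeasure P] (hm : m ≤ m₀) {A : Set Ω} (hA : MeasurableSet[m₀] A) :
    ∀ᵐ ω ∂P, (P⟦A | m⟧) ω ∈ Set.Icc (0 : ℝ) 1 := by
  have hi : Integrable (A.indicator fun _ => (1 : ℝ)) P := (integrable_const 1).indicator hA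
  have h0 : 0 ≤ᵐ[P] P⟦A | m⟧ :=
    condExp_nonneg (ae_of_all _ fun ω => Set.indicator_nonneg (fun _ _ => zero_le_one) ω)
  have h1 : P⟦A | m⟧ ≤ᵐ[P] P[fun _ => (1 : ℝ) | m] :=
    condExp_mono hi (integrable_const 1) (ae_of_all _ fun ω =>
      Set.indicator_le_self' (fun _ _ => zero_le_one) ω)
  rw [condExp_const hm] at h1
  filter_upwards [h0, h1] with ω a b
  exact ⟨a, b⟩

lemma integral_condVar_eq_integral_sq [IsFiniteMeasure P] (hm : m ≤ m₀) (X : Ω → ℝ) :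
    ∫ ω, (Var[X; P | m]) ω ∂P = ∫ ω, (X ω - (P[X | m]) ω) ^ 2 ∂P := by
  rw [condVar, integral_condExp hm]
  rfl

lemma integral_condVar_eq_sub [IsFiniteMeasure P] (hm : m ≤ m₀) {X : Ω → ℝ} (hX : MemLp X 2 P) :
    ∫ ω, (Var[X; P | m]) ω ∂P = ∫ ω, X ω ^ 2 ∂P - ∫ ω, (P[X | m]) ω ^ 2 ∂P := by
  have h2 : Integrable ((P[X | m]) ^ 2) P := (hX.condExp one_le_two).integrable_sq
  rw [integral_congr_ae (condVar_ae_eq_condExp_sq_sub_sq_condExp hm hX)]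
  simp only [Pi.sub_apply]
  rw [integral_sub integrable_condExp h2, integral_condExp hm]
  rfl

lemma memLp_indicator_one [IsFiniteMeasure P] {A : Set Ω} (hA : MeasurableSet[m₀] A) :
    MemLp (A.indicator fun _ => (1 : ℝ)) 2 P :=
  (memLp_const (1 : ℝ)).indicator hA

lemma integral_condVar_indicator [IsFiniteMeasure P] (hm : m ≤ m₀) {A : Set Ω}
    (hA : MeasurableSet[m₀] A) :
    ∫ ω, (Var[A.indicator (fun _ => (1 : ℝ)); P | m]) ω ∂P =
      ∫ ω, (P⟦A | m⟧) ω * (1 - (P⟦A | m⟧) ω) ∂P := by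
  have hi : Integrable (A.indicator fun _ => (1 : ℝ)) P := (integrable_const 1).indicator hA
  have h2 : Integrable (fun ω => (P⟦A | m⟧) ω ^ 2) P :=
    ((memLp_indicator_one hA).condExp one_le_two).integrable_sq
  rw [integral_condVar_eq_sub hm (memLp_indicator_one hA)]
  have e1 : ∀ ω, A.indicator (fun _ => (1 : ℝ)) ω ^ 2 = A.indicator (fun _ => (1 : ℝ)) ω := by
    intro ω
    by_cases h : ω ∈ A <;> simp [h]
  simp_rw [e1]
  rw [← integral_condExp hm (f := A.indicator fun _ => (1 : ℝ)), ← integral_sub integrable_condExp h2]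
  refine integral_congr_ae (ae_of_all _ fun ω => ?_)
  ring

/-- The mean conditional variance of the indicator of `t ≤ Y` given the σ-algebra `m`. -/
def condSpread (P : Measure[m₀] Ω) (Y : Ω → ℝ) (m : MeasurableSpace Ω) (t : ℝ) : ℝ :=
  ∫ ω, (Var[{ω' | t ≤ Y ω'}.indicator (fun _ => (1 : ℝ)); P | m]) ω ∂P

variable {Y : Ω → ℝ}

lemma measurableSet_threshold (hY : Measurable[m₀] Y) (t : ℝ) : MeasurableSet[m₀] {ω | t ≤ Y ω} :=
  hY measurableSet_Ici

lemma condSpread_eq_integral_sq [IsFiniteMeasure P] (hm : m ≤ m₀) (t : ℝ) :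
    condSpread P Y m t = ∫ ω, ({ω' | t ≤ Y ω'}.indicator (fun _ => (1 : ℝ)) ω -
      (P⟦{ω' | t ≤ Y ω'} | m⟧) ω) ^ 2 ∂P :=
  integral_condVar_eq_integral_sq hm _

lemma condSpread_nonneg [IsFiniteMeasure P] (hm : m ≤ m₀) (t : ℝ) : 0 ≤ condSpread P Y m t := by
  rw [condSpread_eq_integral_sq hm]
  exact integral_nonneg fun _ => sq_nonneg _

lemma condSpread_eq_zero_iff [IsFiniteMeasure P] (hm : m ≤ m₀) (hY : Measurable[m₀] Y) (t : ℝ) :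
    condSpread P Y m t = 0 ↔
      {ω' | t ≤ Y ω'}.indicator (fun _ => (1 : ℝ)) =ᵐ[P] P⟦{ω' | t ≤ Y ω'} | m⟧ := by
  have hL := memLp_indicator_one (P := P) (measurableSet_threshold hY t)
  have hi : Integrable (fun ω => ({ω' | t ≤ Y ω'}.indicator (fun _ => (1 : ℝ)) ω -
      (P⟦{ω' | t ≤ Y ω'} | m⟧) ω) ^ 2) P := (hL.sub (hL.condExp one_le_two)).integrable_sq
  rw [condSpread_eq_integral_sq hm, integral_eq_zero_iff_of_nonneg (fun _ => sq_nonneg _) hi]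
  refine ⟨fun h => ?_, fun h => ?_⟩
  · filter_upwards [h] with ω hω
    exact sub_eq_zero.1 (pow_eq_zero_iff two_ne_zero |>.1 hω)
  · filter_upwards [h] with ω hω
    rw [hω]
    simp

lemma integrable_condProb_mul [IsFiniteMeasure P] {A : Set Ω}
    (hA : MeasurableSet[m₀] A) :
    Integrable (fun ω => (P⟦A | m⟧) ω * (1 - (P⟦A | m⟧) ω)) P := by
  have h2 : Integrable (fun ω => (P⟦A | m⟧) ω ^ 2) P :=
    ((memLp_indicator_one hA).condExp one_le_two).integrable_sq
  refine ((integrable_condExp (m := m) (μ := P) (f := A.indicator fun _ => (1 : ℝ))).sub h2).congr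
    (ae_of_all _ fun ω => ?_)
  simp only [Pi.sub_apply]
  ring

/-- The map p ↦ p(1 - p) is 1-Lipschitz on [0, 1], and the conditional probabilities at s and t
differ by that of Y ∈ [s, t). The tail bound is p(1 - p) ≤ p. -/
lemma condSpread_intervalControlled [IsProbabilityMeasure P] (hm : m ≤ m₀)
    (hY : Measurable[m₀] Y) : IntervalControlled (P.map Y) (condSpread P Y m) := by
  have hA := fun t => measurableSet_threshold hY t
  refine ⟨1, one_pos, fun s t hst => ?_, fun t => ?_⟩
  · have mD : MeasurableSet (Y ⁻¹' Set.Ico s t) := hY measurableSet_Ico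
    have hd : P⟦{ω | s ≤ Y ω} | m⟧ - P⟦{ω | t ≤ Y ω} | m⟧ =ᵐ[P] P⟦Y ⁻¹' Set.Ico s t | m⟧ := by
      refine (condExp_sub ((integrable_const (1 : ℝ)).indicator (hA s))
        ((integrable_const (1 : ℝ)).indicator (hA t)) m).symm.trans (EventuallyEq.of_eq ?_)
      congr 1
      ext ω
      simp only [Pi.sub_apply, Set.indicator, Set.mem_ofPred_eq, Set.mem_preimage, Set.mem_Ico]
      by_cases h1 : s ≤ Y ω <;> by_cases h2 : t ≤ Y ω
      · simp [h1, h2]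
      · simp [h1, h2, not_le.1 h2]
      · exact absurd (hst.trans h2) h1
      · simp [h1, h2]
    rw [one_mul, map_measureReal_apply hY measurableSet_Ico]
    unfold condSpread
    rw [integral_condVar_indicator hm (hA s), integral_condVar_indicator hm (hA t),
      ← integral_sub (integrable_condProb_mul (hA s)) (integrable_condProb_mul (hA t))]
    have e : P.real (Y ⁻¹' Set.Ico s t) = ∫ ω, (P⟦Y ⁻¹' Set.Ico s t | m⟧) ω ∂P := by
      rw [integral_condExp hm, integral_indicator_const _ mD, smul_eq_mul, mul_one]
    rw [e]
    refine (abs_integral_le_integral_abs).trans (integral_mono_ae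
      ((integrable_condProb_mul (hA s)).sub (integrable_condProb_mul (hA t))).abs
      integrable_condExp ?_)
    filter_upwards [hd, condProb_mem_Icc hm mD, condProb_mem_Icc hm (hA s),
      condProb_mem_Icc hm (hA t)] with ω h1 h2 h3 h4
    simp only [Pi.sub_apply] at h1
    rw [← h1] at h2 ⊢
    obtain ⟨h5, -⟩ := h2
    obtain ⟨h6, h7⟩ := h3
    obtain ⟨h8, h9⟩ := h4
    rw [abs_le]
    constructor <;> nlinarith
  · rw [abs_of_nonneg (condSpread_nonneg hm t), one_mul, map_measureReal_apply hY measurableSet_Ici]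
    unfold condSpread
    rw [integral_condVar_indicator hm (hA t)]
    have e : P.real (Y ⁻¹' Set.Ici t) = ∫ ω, (P⟦{ω | t ≤ Y ω} | m⟧) ω ∂P := by
      rw [integral_condExp hm, integral_indicator_const _ (hA t), smul_eq_mul, mul_one]
      rfl
    rw [e]
    refine integral_mono_ae (integrable_condProb_mul (hA t)) integrable_condExp ?_
    filter_upwards [condProb_mem_Icc hm (hA t)] with ω h
    exact mul_le_of_le_one_right h.1 (by linarith [h.1])

lemma IntervalControlled.sub {μ : Measure ℝ} {a b : ℝ → ℝ}
    (ha : IntervalControlled μ a) (hb : IntervalControlled μ b) :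
    IntervalControlled μ fun t => a t - b t := by
  obtain ⟨C, hC, h1, h2⟩ := ha
  obtain ⟨D, hD, h3, h4⟩ := hb
  refine ⟨C + D, add_pos hC hD, fun s t h => ?_, fun t => ?_⟩
  · have e : a s - b s - (a t - b t) = (a s - a t) - (b s - b t) := by ring
    rw [e, add_mul]
    exact (abs_sub _ _).trans (add_le_add (h1 s t h) (h3 s t h))
  · rw [add_mul]
    exact (abs_sub _ _).trans (add_le_add (h2 t) (h4 t))

lemma IntervalControlled.integral_eq_zero_iff {μ : Measure ℝ} [IsProbabilityMeasure μ] {a : ℝ → ℝ}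
    (ha : IntervalControlled μ a) (h0 : ∀ t, 0 ≤ a t) : ∫ t, a t ∂μ = 0 ↔ ∀ t, a t = 0 := by
  refine ⟨fun h => ha.eq_zero ((integral_eq_zero_iff_of_nonneg h0 ha.integrable).1 h), fun h => ?_⟩
  simp [h]

/-- The mean conditional variance of a conditional probability is a difference of spreads. -/
lemma integral_condVar_condProb [IsFiniteMeasure P] {m₁ m₂ : MeasurableSpace Ω} (h12 : m₁ ≤ m₂)
    (hm₂ : m₂ ≤ m₀) (hY : Measurable[m₀] Y) (t : ℝ) :
    ∫ ω, (Var[P⟦{ω' | t ≤ Y ω'} | m₂⟧; P | m₁]) ω ∂P = condSpread P Y m₁ t - condSpread P Y m₂ t := by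
  have hL := memLp_indicator_one (P := P) (measurableSet_threshold hY t)
  unfold condSpread
  rw [integral_condVar_eq_sub (h12.trans hm₂) (hL.condExp one_le_two),
    integral_condVar_eq_sub (h12.trans hm₂) hL, integral_condVar_eq_sub hm₂ hL]
  have e : ∫ ω, (P[P⟦{ω' | t ≤ Y ω'} | m₂⟧ | m₁]) ω ^ 2 ∂P =
      ∫ ω, (P⟦{ω' | t ≤ Y ω'} | m₁⟧) ω ^ 2 ∂P := by
    refine integral_congr_ae ?_
    filter_upwards [condExp_condExp_of_le h12 hm₂ (μ := P)
      (f := {ω' | t ≤ Y ω'}.indicator fun _ => (1 : ℝ))] with ω hω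
    rw [hω]
  rw [e]
  ring

lemma condSpread_le_of_le [IsFiniteMeasure P] {m₁ m₂ : MeasurableSpace Ω} (h12 : m₁ ≤ m₂)
    (hm₂ : m₂ ≤ m₀) (hY : Measurable[m₀] Y) (t : ℝ) : condSpread P Y m₂ t ≤ condSpread P Y m₁ t := by
  rw [← sub_nonneg, ← integral_condVar_condProb h12 hm₂ hY,
    integral_condVar_eq_integral_sq (h12.trans hm₂)]
  exact integral_nonneg fun _ => sq_nonneg _

/-- By the tower property the difference is the squared L² distance between the two conditional
probabilities. -/
lemma condSpread_eq_iff [IsFiniteMeasure P] {m₁ m₂ : MeasurableSpace Ω} (h12 : m₁ ≤ m₂)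
    (hm₂ : m₂ ≤ m₀) (hY : Measurable[m₀] Y) (t : ℝ) :
    condSpread P Y m₁ t - condSpread P Y m₂ t = 0 ↔
      P⟦{ω' | t ≤ Y ω'} | m₂⟧ =ᵐ[P] P⟦{ω' | t ≤ Y ω'} | m₁⟧ := by
  have hL := memLp_indicator_one (P := P) (measurableSet_threshold hY t)
  have hi : Integrable (fun ω => ((P⟦{ω' | t ≤ Y ω'} | m₂⟧) ω -
      (P[P⟦{ω' | t ≤ Y ω'} | m₂⟧ | m₁]) ω) ^ 2) P :=
    ((hL.condExp one_le_two).sub ((hL.condExp one_le_two).condExp one_le_two)).integrable_sq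
  have ht := condExp_condExp_of_le h12 hm₂ (μ := P)
    (f := {ω' | t ≤ Y ω'}.indicator fun _ => (1 : ℝ))
  rw [← integral_condVar_condProb h12 hm₂ hY, integral_condVar_eq_integral_sq (h12.trans hm₂),
    integral_eq_zero_iff_of_nonneg (fun _ => sq_nonneg _) hi]
  refine ⟨fun h => ?_, fun h => ?_⟩
  · filter_upwards [h, ht] with ω h1 h2
    rw [← h2]
    exact sub_eq_zero.1 (pow_eq_zero_iff two_ne_zero |>.1 h1)
  · filter_upwards [h, ht] with ω h1 h2
    rw [h2, h1]
    simp

end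

/-! ### Functional dependence -/

section

variable {Ω 𝒰 : Type*} [MeasurableSpace Ω] [MeasurableSpace 𝒰] {P : Measure Ω}
  [IsProbabilityMeasure P] {Y : Ω → ℝ} {U : Ω → 𝒰}

/-- Zero spread makes each indicator 1{q ≤ Y}, q rational, almost surely equal to its conditional
probability given U. So Y is the supremum of the rationals q at which this function of U equals 1;
working in `EReal` keeps the supremum meaningful off the good event. -/
lemma exists_eq_of_condSpread_eq_zero (hY : Measurable Y) (hU : Measurable U)
    (h : ∀ t, condSpread P Y (MeasurableSpace.comap U inferInstance) t = 0) :
    ∃ f : 𝒰 → ℝ, Measurable f ∧ ∀ᵐ ω ∂P, Y ω = f (U ω) := by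
  set g : ℚ → 𝒰 → ℝ := fun q u => (condDistrib Y U P u).real (Set.Ici (q : ℝ)) with hg
  have mg : ∀ q, Measurable (g q) := fun q =>
    (Kernel.measurable_coe _ measurableSet_Ici).ennreal_toReal
  have hYq : ∀ q : ℚ, ∀ᵐ ω ∂P, (g q (U ω) = 1 ↔ (q : ℝ) ≤ Y ω) := by
    intro q
    have h1 := (condSpread_eq_zero_iff hU.comap_le hY (q : ℝ)).1 (h q)
    have h2 := condDistrib_ae_eq_condExp (μ := P) hU hY (measurableSet_Ici (a := (q : ℝ)))
    filter_upwards [h1, h2] with ω a b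
    have b' : g q (U ω) = _ := b
    rw [b', show Y ⁻¹' Set.Ici (q : ℝ) = {ω' | (q : ℝ) ≤ Y ω'} from rfl, ← a]
    by_cases hq : (q : ℝ) ≤ Y ω <;> simp [hq]
  refine ⟨fun u => (⨆ q : ℚ, if g q u = 1 then ((q : ℝ) : EReal) else ⊥).toReal,
    measurable_ereal_toReal.comp (Measurable.iSup fun q =>
      Measurable.ite (mg q (measurableSet_singleton 1)) measurable_const measurable_const), ?_⟩
  filter_upwards [ae_all_iff.2 hYq] with ω hω
  have e : (⨆ q : ℚ, if g q (U ω) = 1 then ((q : ℝ) : EReal) else ⊥) = (Y ω : EReal) := by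
    refine le_antisymm (iSup_le fun q => ?_) (le_of_forall_lt fun c hc => ?_)
    · split_ifs with hq
      · exact EReal.coe_le_coe_iff.2 ((hω q).1 hq)
      · exact bot_le
    · obtain ⟨q, h1, h2⟩ := EReal.lt_iff_exists_rat_btwn.1 hc
      refine h1.trans_le ((le_of_eq ?_).trans (le_iSup _ q))
      rw [if_pos ((hω q).2 (EReal.coe_lt_coe_iff.1 h2).le)]
  rw [e, EReal.toReal_coe]

lemma condSpread_eq_zero_of_eq (hY : Measurable Y) (hU : Measurable U) {f : 𝒰 → ℝ}
    (hf : Measurable f) (h : ∀ᵐ ω ∂P, Y ω = f (U ω)) (t : ℝ) :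
    condSpread P Y (MeasurableSpace.comap U inferInstance) t = 0 := by
  rw [condSpread_eq_zero_iff hU.comap_le hY]
  have e : {ω' | t ≤ Y ω'}.indicator (fun _ => (1 : ℝ)) =ᵐ[P]
      {ω' | t ≤ f (U ω')}.indicator fun _ => (1 : ℝ) := by
    filter_upwards [h] with ω hω
    simp only [Set.indicator, Set.mem_ofPred_eq, hω]
  have mS : MeasurableSet[MeasurableSpace.comap U inferInstance] {ω' | t ≤ f (U ω')} :=
    ⟨f ⁻¹' Set.Ici t, hf measurableSet_Ici, rfl⟩
  have hs : StronglyMeasurable[MeasurableSpace.comap U inferInstance]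
      ({ω' | t ≤ f (U ω')}.indicator fun _ => (1 : ℝ)) :=
    stronglyMeasurable_const.indicator mS
  have h2 := condExp_of_stronglyMeasurable hU.comap_le (μ := P) hs
    ((integrable_const (1 : ℝ)).indicator (hU.comap_le _ mS))
  refine e.trans ?_
  rw [← h2]
  exact (condExp_congr_ae e).symm

/-- The integrated spread vanishes exactly when `Y` is almost surely a function of `U`. -/
lemma integral_condSpread_eq_zero_iff (hY : Measurable Y) (hU : Measurable U) :
    ∫ t, condSpread P Y (MeasurableSpace.comap U inferInstance) t ∂(P.map Y) = 0 ↔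
      ∃ f : 𝒰 → ℝ, Measurable f ∧ ∀ᵐ ω ∂P, Y ω = f (U ω) := by
  have : IsProbabilityMeasure (P.map Y) := Measure.isProbabilityMeasure_map hY.aemeasurable
  rw [(condSpread_intervalControlled hU.comap_le hY).integral_eq_zero_iff
    (condSpread_nonneg hU.comap_le)]
  constructor
  · exact exists_eq_of_condSpread_eq_zero hY hU
  · rintro ⟨f, hf, h⟩
    exact condSpread_eq_zero_of_eq hY hU hf h

end

/-! ### Convergence of the coefficient -/

section

variable {Ω₀ Ω : Type*} [MeasurableSpace Ω₀] [MeasurableSpace Ω]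
  {P : Measure Ω₀} {Q : Measure Ω} [IsProbabilityMeasure P]

lemma condSpread_bot {V : Ω₀ → ℝ} (hV : Measurable V) (t : ℝ) :
    condSpread P V ⊥ t = (P.map V).real (Set.Ici t) * (1 - (P.map V).real (Set.Ici t)) := by
  have hA := measurableSet_threshold hV t
  rw [condSpread, integral_condVar_indicator bot_le hA, condExp_bot,
    integral_indicator_const _ hA, map_measureReal_apply hV measurableSet_Ici]
  simp only [smul_eq_mul, mul_one, integral_const, probReal_univ, one_mul]
  rfl

lemma condSpread_comap_eq {U V : Ω₀ → ℝ} (hU : Measurable U) (hV : Measurable V) (t : ℝ) :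
    condSpread P V (MeasurableSpace.comap U inferInstance) t =
      ∫ ω, (condDistrib V U P (U ω)).real (Set.Ici t) *
        (1 - (condDistrib V U P (U ω)).real (Set.Ici t)) ∂P := by
  rw [condSpread, integral_condVar_indicator hU.comap_le (measurableSet_threshold hV t)]
  refine integral_congr_ae ?_
  filter_upwards [condDistrib_ae_eq_condExp (μ := P) hU hV (measurableSet_Ici (a := t))] with ω h
  rw [h]
  rfl

lemma xiNum_comp_perm_eq_avg {n : ℕ} (v : Fin n → ℝ) (s : Equiv.Perm (Fin n)) :
    xiNum (v ∘ s) = n ^ 3 * avg (fun t => jumps (v ∘ s) t / n) v := by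
  rw [xiNum_comp_perm, avg, ← Finset.sum_div]
  rcases Nat.eq_zero_or_pos n with rfl | hn
  · simp
  · field_simp

/-- Since l_i is n times the empirical tail at y_i, the normalisation n³ matches that of the
numerator and cancels in ξ_n. -/
lemma xiDen_eq_avg {n : ℕ} (v : Fin n → ℝ) :
    xiDen v = 2 * (n ^ 3 * avg (fun t => avg (geInd t) v * (1 - avg (geInd t) v)) v) := by
  rcases Nat.eq_zero_or_pos n with rfl | hn
  · simp [xiDen]
  · have hn' : (n : ℝ) ≠ 0 := (Nat.cast_pos.2 hn).ne'
    simp only [xiDen, upperRank_eq_sum, avg, Finset.sum_div, Finset.mul_sum]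
    refine Finset.sum_congr rfl fun i _ => ?_
    rw [← Finset.sum_div]
    field_simp

/-- Passage from a fixed level to the sample points as levels: crossing frequencies have increments
at most twice the empirical mass of the interval. -/
lemma tendsto_jumps_avg_ae [IsProbabilityMeasure Q] {U V : ℕ → Ω → ℝ} {U' V' : Ω₀ → ℝ}
    (hU : ∀ i, Measurable (U i)) (hV : ∀ i, Measurable (V i))
    (hU' : Measurable U') (hV' : Measurable V')
    (hind : iIndepFun (fun i ω => (U i ω, V i ω)) Q)
    (hlaw : ∀ i, IdentDistrib (fun ω => (U i ω, V i ω)) (fun ω => (U' ω, V' ω)) Q P)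
    {σ : (n : ℕ) → Ω → Equiv.Perm (Fin n)}
    (hσ : ∀ n, IsUniformSort Q (fun (i : Fin n) => U i) (fun (i : Fin n) => V i) (σ n)) :
    ∀ᵐ ω ∂Q, Tendsto (fun n => avg (fun t => jumps ((fun i : Fin n => V i ω) ∘ σ n ω) t / n)
      (fun i : Fin n => V i ω)) atTop
      (𝓝 (2 * ∫ t, condSpread P V' (MeasurableSpace.comap U' inferInstance) t ∂(P.map V'))) := by
  have hc := condSpread_intervalControlled (P := P) hU'.comap_le hV'
  have hc2 : IntervalControlled (P.map V')
      fun t => 2 * condSpread P V' (MeasurableSpace.comap U' inferInstance) t := by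
    obtain ⟨C, hC, h1, h2⟩ := hc
    refine ⟨2 * C, by linarith, fun s t h => ?_, fun t => ?_⟩
    · rw [← mul_sub, abs_mul, abs_two, mul_assoc]
      exact mul_le_mul_of_nonneg_left (h1 s t h) zero_le_two
    · rw [abs_mul, abs_two, mul_assoc]
      exact mul_le_mul_of_nonneg_left (h2 t) zero_le_two
  have h := tendsto_avg_of_controlled hV'
    (hind.comp (fun _ => Prod.snd) fun _ => measurable_snd)
    (fun i => (hlaw i).comp measurable_snd)
    (a := fun n ω t => jumps ((fun i : Fin n => V i ω) ∘ σ n ω) t / n) zero_le_two ?_ hc2 ?_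
  · rw [integral_const_mul] at h
    exact h
  · intro n ω s t hst
    have h1 := abs_jumps_sub_le ((fun i : Fin n => V i ω) ∘ σ n ω) hst
    have h2 := avg_comp_perm ((Set.Ico s t).indicator fun _ => (1 : ℝ))
      (fun i : Fin n => V i ω) (σ n ω)
    change _ ≤ 2 * avg ((Set.Ico s t).indicator fun _ => (1 : ℝ)) (fun i : Fin n => V i ω)
    rw [← h2, ← sub_div, abs_div, Nat.abs_cast, avg, mul_div_assoc']
    exact div_le_div_of_nonneg_right h1 (Nat.cast_nonneg n)
  · intro t
    have h1 := tendsto_jumps_ae hU hV hU' hV' hind hlaw hσ t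
    rw [← condSpread_comap_eq hU' hV'] at h1
    exact h1

lemma tendsto_upperRank_avg_ae [IsProbabilityMeasure Q] {V : ℕ → Ω → ℝ} {V' : Ω₀ → ℝ}
    (hV' : Measurable V') (hind : iIndepFun V Q) (hlaw : ∀ i, IdentDistrib (V i) V' Q P) :
    ∀ᵐ ω ∂Q, Tendsto (fun n => avg (fun t => avg (geInd t) (fun i : Fin n => V i ω) *
      (1 - avg (geInd t) (fun i : Fin n => V i ω))) (fun i : Fin n => V i ω)) atTop
      (𝓝 (∫ t, condSpread P V' ⊥ t ∂(P.map V'))) := by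
  refine tendsto_avg_of_controlled hV' hind hlaw
    (a := fun n ω t => avg (geInd t) (fun i : Fin n => V i ω) *
      (1 - avg (geInd t) (fun i : Fin n => V i ω))) zero_le_one ?_
    (condSpread_intervalControlled bot_le hV') ?_
  · intro n ω s t hst
    have h01 : ∀ t, avg (geInd t) (fun i : Fin n => V i ω) ∈ Set.Icc (0 : ℝ) 1 := by
      intro t
      refine ⟨avg_nonneg _ (geInd_nonneg t), div_le_one_of_le₀ ?_ (Nat.cast_nonneg n)⟩
      refine (Finset.sum_le_sum fun j _ => geInd_le_one t _).trans ?_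
      simp
    have h1 := abs_sum_geInd_sub (fun i : Fin n => V i ω) hst
    have h2 : |avg (geInd s) (fun i : Fin n => V i ω) - avg (geInd t) (fun i : Fin n => V i ω)| =
        avg ((Set.Ico s t).indicator fun _ => (1 : ℝ)) (fun i : Fin n => V i ω) := by
      rw [avg, avg, ← sub_div, abs_div, Nat.abs_cast, h1]
      rfl
    change _ ≤ 1 * avg ((Set.Ico s t).indicator fun _ => (1 : ℝ)) (fun i : Fin n => V i ω)
    rw [one_mul, ← h2]
    set a := avg (geInd s) (fun i : Fin n => V i ω)
    set b := avg (geInd t) (fun i : Fin n => V i ω)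
    have e : a * (1 - a) - b * (1 - b) = (a - b) * (1 - a - b) := by ring
    rw [e, abs_mul]
    refine mul_le_of_le_one_right (abs_nonneg _) ?_
    rw [abs_le]
    constructor <;> linarith [(h01 s).1, (h01 s).2, (h01 t).1, (h01 t).2]
  · intro t
    have e1 : geInd t = (Set.Ici t).indicator fun _ => (1 : ℝ) := by
      ext v
      simp [geInd, Set.indicator]
    filter_upwards [tendsto_avg_indicator_ae hV' hind hlaw (measurableSet_Ici (a := t))] with ω h
    rw [condSpread_bot hV']
    simp only [e1]
    exact h.mul (tendsto_const_nhds.sub h)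

lemma tendsto_xi_ae [IsProbabilityMeasure Q] {U V : ℕ → Ω → ℝ} {U' V' : Ω₀ → ℝ}
    (hU : ∀ i, Measurable (U i)) (hV : ∀ i, Measurable (V i))
    (hU' : Measurable U') (hV' : Measurable V')
    (hind : iIndepFun (fun i ω => (U i ω, V i ω)) Q)
    (hlaw : ∀ i, IdentDistrib (fun ω => (U i ω, V i ω)) (fun ω => (U' ω, V' ω)) Q P)
    {σ : (n : ℕ) → Ω → Equiv.Perm (Fin n)}
    (hσ : ∀ n, IsUniformSort Q (fun (i : Fin n) => U i) (fun (i : Fin n) => V i) (σ n))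
    (hD : 0 < ∫ t, condSpread P V' ⊥ t ∂(P.map V')) :
    ∀ᵐ ω ∂Q, (∀ᶠ n : ℕ in atTop, xiDen (fun i : Fin n => V i ω) ≠ 0) ∧
      Tendsto (fun n => xi (σ n ω) (fun i : Fin n => V i ω)) atTop
        (𝓝 (1 - (∫ t, condSpread P V' (MeasurableSpace.comap U' inferInstance) t ∂(P.map V')) /
          ∫ t, condSpread P V' ⊥ t ∂(P.map V'))) := by
  filter_upwards [tendsto_jumps_avg_ae hU hV hU' hV' hind hlaw hσ,
    tendsto_upperRank_avg_ae hV' (hind.comp (fun _ => Prod.snd) fun _ => measurable_snd)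
      fun i => (hlaw i).comp measurable_snd] with ω h1 h2
  constructor
  · filter_upwards [(tendsto_order.1 h2).1 0 hD, eventually_gt_atTop 0] with n hn hn0
    have hn0' : (0 : ℝ) < n := Nat.cast_pos.2 hn0
    rw [xiDen_eq_avg]
    positivity
  · have h3 := (h1.div (h2.const_mul 2) (by positivity)).const_sub 1
    rw [mul_div_mul_left _ _ two_ne_zero] at h3
    refine h3.congr' ?_
    filter_upwards [eventually_gt_atTop 0] with n hn0
    have hn0' : (n : ℝ) ^ 3 ≠ 0 := pow_ne_zero _ (Nat.cast_pos.2 hn0).ne'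
    rw [xi, xiDen_comp_perm, xiNum_comp_perm_eq_avg, xiDen_eq_avg, mul_left_comm (2 : ℝ),
      mul_div_mul_left _ _ hn0']
    rfl

end

/-! ### Conditional independence -/

lemma condIndepGiven_comp_iff {Ω 𝒳 𝒴 𝒵 : Type*} [MeasurableSpace Ω] [MeasurableSpace 𝒳]
    [MeasurableSpace 𝒴] [MeasurableSpace 𝒵] {P : Measure Ω} {X : Ω → 𝒳} {Z : Ω → 𝒵}
    {Y : Ω → 𝒴} {ψ : 𝒴 → ℝ} (hψ : MeasurableEmbedding ψ) :
    CondIndepGiven P (fun ω => ψ (Y ω)) Z X ↔ CondIndepGiven P Y Z X := by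
  constructor
  · intro h A B hA hB
    have e : (fun ω => ψ (Y ω)) ⁻¹' (ψ '' A) = Y ⁻¹' A := by
      ext ω
      simp [hψ.injective.mem_set_image]
    have := h (ψ '' A) B (hψ.measurableSet_image.2 hA) hB
    rwa [e] at this
  · intro h A B hA hB
    exact h (ψ ⁻¹' A) B (hψ.measurable hA) hB

/-- On each D in m, the law of Y and the mixture of its conditional distributions given X agree on
half-lines, hence on all Borel sets. So the conditional distribution given X is also a version given
m. -/
lemma condProb_eq_of_forall_threshold {Ω 𝒳 : Type*} {m m₀ : MeasurableSpace Ω}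
    [MeasurableSpace 𝒳] {P : Measure Ω} [IsProbabilityMeasure P] {X : Ω → 𝒳} {Y : Ω → ℝ}
    (hY : Measurable Y) (hX : Measurable X) (hm : m ≤ m₀)
    (hXm : MeasurableSpace.comap X inferInstance ≤ m)
    (h : ∀ t, P⟦{ω | t ≤ Y ω} | m⟧ =ᵐ[P] P⟦{ω | t ≤ Y ω} | MeasurableSpace.comap X inferInstance⟧)
    {A : Set ℝ} (hA : MeasurableSet A) :
    P⟦Y ⁻¹' A | m⟧ =ᵐ[P] P⟦Y ⁻¹' A | MeasurableSpace.comap X inferInstance⟧ := by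
  have mκ : Measurable fun ω => condDistrib Y X P (X ω) :=
    (condDistrib Y X P).measurable.comp hX
  have hreal : ∀ {B : Set ℝ}, MeasurableSet B →
      Measurable fun ω => (condDistrib Y X P (X ω)).real B := fun hB =>
    ((Kernel.measurable_coe _ hB).comp hX).ennreal_toReal
  have hint : ∀ {B : Set ℝ}, MeasurableSet B →
      Integrable (fun ω => (condDistrib Y X P (X ω)).real B) P := fun hB =>
    Integrable.of_bound (hreal hB).aestronglyMeasurable 1 (ae_of_all _ fun ω => by
      rw [Real.norm_eq_abs, abs_of_nonneg measureReal_nonneg]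
      exact measureReal_le_one)
  have hlin : ∀ {B : Set ℝ}, MeasurableSet B → ∀ D : Set Ω,
      ∫⁻ ω in D, condDistrib Y X P (X ω) B ∂P =
        ENNReal.ofReal (∫ ω in D, (condDistrib Y X P (X ω)).real B ∂P) := by
    intro B hB D
    rw [ofReal_integral_eq_lintegral_ofReal (hint hB).integrableOn
      (ae_of_all _ fun _ => measureReal_nonneg)]
    exact lintegral_congr fun ω => (ofReal_measureReal).symm
  have key : ∀ D, MeasurableSet[m] D →
      (P.restrict D).map Y = (P.restrict D).bind fun ω => condDistrib Y X P (X ω) := by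
    intro D hD
    refine Measure.ext_of_Ici _ _ fun t => ?_
    rw [Measure.map_apply hY measurableSet_Ici, Measure.bind_apply measurableSet_Ici mκ.aemeasurable,
      hlin measurableSet_Ici]
    have h1 := setIntegral_condExp hm (μ := P)
      ((integrable_const (1 : ℝ)).indicator (measurableSet_threshold hY t)) hD
    have h2 : ∫ ω in D, (condDistrib Y X P (X ω)).real (Set.Ici t) ∂P =
        ∫ ω in D, (P⟦{ω | t ≤ Y ω} | m⟧) ω ∂P :=
      integral_congr_ae (ae_restrict_of_ae
        ((condDistrib_ae_eq_condExp hX hY measurableSet_Ici).trans (h t).symm))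
    rw [h2, h1, integral_indicator_const _ (measurableSet_threshold hY t), smul_eq_mul, mul_one,
      ofReal_measureReal]
    rfl
  have hκ := condDistrib_ae_eq_condExp (μ := P) hX hY hA
  refine EventuallyEq.trans (ae_eq_condExp_of_forall_setIntegral_eq hm (μ := P)
    (f := (Y ⁻¹' A).indicator fun _ => (1 : ℝ))
    (g := fun ω => (condDistrib Y X P (X ω)).real A)
    ((integrable_const (1 : ℝ)).indicator (hY hA)) (fun _ _ _ => (hint hA).integrableOn) ?_ ?_).symm hκ
  · intro D hD _
    have h1 := DFunLike.congr_fun (key D hD) A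
    rw [Measure.map_apply hY hA, Measure.bind_apply hA mκ.aemeasurable, hlin hA,
      ← ofReal_measureReal (μ := P.restrict D)] at h1
    rw [ENNReal.ofReal_eq_ofReal_iff measureReal_nonneg
      (integral_nonneg fun _ => measureReal_nonneg)] at h1
    rw [← h1, integral_indicator_const _ (hY hA), smul_eq_mul, mul_one]
  · refine (Measurable.stronglyMeasurable ?_).aestronglyMeasurable
    refine Measurable.ennreal_toReal ?_
    exact (Kernel.measurable_coe _ hA).comp ((comap_measurable X).mono hXm le_rfl)

lemma indicator_inter_one_eq_mul {Ω : Type*} (A B : Set Ω) :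
    (A ∩ B).indicator (fun _ => (1 : ℝ)) =
      B.indicator (fun _ => (1 : ℝ)) * A.indicator fun _ => (1 : ℝ) := by
  ext ω
  by_cases h1 : ω ∈ A <;> by_cases h2 : ω ∈ B <;> simp [h1, h2]

section

variable {Ω 𝒳 𝒴 𝒵 : Type*} [MeasurableSpace Ω] [MeasurableSpace 𝒳] [MeasurableSpace 𝒴]
  [MeasurableSpace 𝒵] {P : Measure Ω} [IsProbabilityMeasure P]
  {X : Ω → 𝒳} {Z : Ω → 𝒵}

/-- Given (Z, X) the indicator of Z ∈ B factors out, leaving P(Y ∈ A | X); conditioning further on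
X, this factor is pulled out in turn. -/
lemma condIndepGiven_of_condProb_eq {Y : Ω → 𝒴} (hY : Measurable Y) (hZ : Measurable Z)
    (hX : Measurable X)
    (h : ∀ A : Set 𝒴, MeasurableSet A →
      P⟦Y ⁻¹' A | MeasurableSpace.comap (fun ω => (Z ω, X ω)) inferInstance⟧ =ᵐ[P]
        P⟦Y ⁻¹' A | MeasurableSpace.comap X inferInstance⟧) : CondIndepGiven P Y Z X := by
  intro A B hA hB
  set m₁ : MeasurableSpace Ω := MeasurableSpace.comap X inferInstance with hm₁
  set m₂ : MeasurableSpace Ω := MeasurableSpace.comap (fun ω => (Z ω, X ω)) inferInstance with hm₂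
  have hle₂ : m₂ ≤ _ := (hZ.prodMk hX).comap_le
  have hle : m₁ ≤ m₂ := by
    rintro _ ⟨C, hC, rfl⟩
    exact ⟨Prod.snd ⁻¹' C, measurable_snd hC, rfl⟩
  have iA : Integrable ((Y ⁻¹' A).indicator fun _ => (1 : ℝ)) P :=
    (integrable_const 1).indicator (hY hA)
  have iB : Integrable ((Z ⁻¹' B).indicator fun _ => (1 : ℝ)) P :=
    (integrable_const 1).indicator (hZ hB)
  have iAB : Integrable ((Y ⁻¹' A ∩ Z ⁻¹' B).indicator fun _ => (1 : ℝ)) P :=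
    (integrable_const 1).indicator ((hY hA).inter (hZ hB))
  have sB : StronglyMeasurable[m₂] ((Z ⁻¹' B).indicator fun _ => (1 : ℝ)) :=
    stronglyMeasurable_const.indicator ⟨Prod.fst ⁻¹' B, measurable_fst hB, rfl⟩
  have e1 : P⟦Y ⁻¹' A ∩ Z ⁻¹' B | m₂⟧ =ᵐ[P]
      P⟦Y ⁻¹' A | m₁⟧ * (Z ⁻¹' B).indicator fun _ => (1 : ℝ) := by
    rw [indicator_inter_one_eq_mul] at iAB ⊢
    refine (condExp_mul_of_stronglyMeasurable_left sB iAB iA).trans ?_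
    filter_upwards [h A hA] with ω hω
    simp only [Pi.mul_apply]
    rw [hω, mul_comm]
  have iP : Integrable (P⟦Y ⁻¹' A | m₁⟧ * (Z ⁻¹' B).indicator fun _ => (1 : ℝ)) P :=
    (integrable_condExp (m := m₂)).congr e1
  refine (condExp_condExp_of_le hle hle₂).symm.trans ((condExp_congr_ae e1).trans ?_)
  exact condExp_mul_of_stronglyMeasurable_left stronglyMeasurable_condExp iP iB

/-- Let p = P(Y ∈ A | X). The measures 1{Y ∈ A}dP and p dP, pushed forward by (Z, X), agree on
rectangles by conditional independence, hence everywhere. -/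
lemma CondIndepGiven.condProb_eq {Y : Ω → 𝒴} (h : CondIndepGiven P Y Z X) (hY : Measurable Y)
    (hZ : Measurable Z) (hX : Measurable X) {A : Set 𝒴} (hA : MeasurableSet A) :
    P⟦Y ⁻¹' A | MeasurableSpace.comap (fun ω => (Z ω, X ω)) inferInstance⟧ =ᵐ[P]
      P⟦Y ⁻¹' A | MeasurableSpace.comap X inferInstance⟧ := by
  have hZX := hZ.prodMk hX
  set p : Ω → ℝ := P⟦Y ⁻¹' A | MeasurableSpace.comap X inferInstance⟧ with hp
  have ip : Integrable p P := integrable_condExp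
  have p0 : 0 ≤ᵐ[P] p := condExp_nonneg (ae_of_all _ fun ω =>
    Set.indicator_nonneg (fun _ _ => zero_le_one) ω)
  have hle : MeasurableSpace.comap X inferInstance ≤
      MeasurableSpace.comap (fun ω => (Z ω, X ω)) inferInstance := by
    rintro _ ⟨C, hC, rfl⟩
    exact ⟨Prod.snd ⁻¹' C, measurable_snd hC, rfl⟩
  have sp : StronglyMeasurable[MeasurableSpace.comap X inferInstance] p := stronglyMeasurable_condExp
  have mp : Measurable p := (sp.mono hX.comap_le).measurable
  have iA : Integrable ((Y ⁻¹' A).indicator fun _ => (1 : ℝ)) P :=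
    (integrable_const 1).indicator (hY hA)
  have key : (P.restrict (Y ⁻¹' A)).map (fun ω => (Z ω, X ω)) =
      (P.withDensity fun ω => ENNReal.ofReal (p ω)).map fun ω => (Z ω, X ω) := by
    refine Measure.ext_prod fun {B C} hB hC => ?_
    have mpre := hZX (hB.prod hC)
    have mB := hZ hB
    have mC : MeasurableSet[MeasurableSpace.comap X inferInstance] (X ⁻¹' C) := ⟨C, hC, rfl⟩
    rw [Measure.map_apply hZX (hB.prod hC), Measure.map_apply hZX (hB.prod hC),
      Measure.restrict_apply mpre, withDensity_apply _ mpre,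
      ← ofReal_integral_eq_lintegral_ofReal ip.integrableOn (ae_restrict_of_ae p0)]
    have eset : (fun ω => (Z ω, X ω)) ⁻¹' (B ×ˢ C) = X ⁻¹' C ∩ Z ⁻¹' B := by
      ext ω
      simp [and_comm]
    have iB : Integrable ((Z ⁻¹' B).indicator fun _ => (1 : ℝ)) P :=
      (integrable_const 1).indicator mB
    have iBp : Integrable (p * (Z ⁻¹' B).indicator fun _ => (1 : ℝ)) P := by
      have : p * (Z ⁻¹' B).indicator (fun _ => (1 : ℝ)) = (Z ⁻¹' B).indicator p := by
        ext ω
        by_cases hω : ω ∈ Z ⁻¹' B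
        · simp only [Pi.mul_apply, Set.indicator_of_mem hω, mul_one]
        · simp only [Pi.mul_apply, Set.indicator_of_notMem hω, mul_zero]
      rw [this]
      exact ip.indicator mB
    have i1 : ∫ ω in X ⁻¹' C ∩ Z ⁻¹' B, p ω ∂P =
        ∫ ω in X ⁻¹' C, (p * (Z ⁻¹' B).indicator fun _ => (1 : ℝ)) ω ∂P := by
      rw [← setIntegral_indicator mB]
      refine integral_congr_ae (ae_of_all _ fun ω => ?_)
      by_cases hω : ω ∈ Z ⁻¹' B
      · simp only [Pi.mul_apply, Set.indicator_of_mem hω, mul_one]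
      · simp only [Pi.mul_apply, Set.indicator_of_notMem hω, mul_zero]
    have i2 := setIntegral_condExp hX.comap_le iBp mC
    have i3 : ∫ ω in X ⁻¹' C, (P[p * (Z ⁻¹' B).indicator (fun _ => (1 : ℝ)) |
        MeasurableSpace.comap X inferInstance]) ω ∂P = ∫ ω in X ⁻¹' C,
        (P⟦Y ⁻¹' A ∩ Z ⁻¹' B | MeasurableSpace.comap X inferInstance⟧) ω ∂P :=
      integral_congr_ae (ae_restrict_of_ae
        ((condExp_mul_of_stronglyMeasurable_left sp iBp iB).trans (h A B hA hB).symm))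
    have i4 := setIntegral_condExp hX.comap_le (μ := P)
      ((integrable_const (1 : ℝ)).indicator ((hY hA).inter mB)) mC
    rw [eset, i1, ← i2, i3, i4, integral_indicator_const _ ((hY hA).inter mB), smul_eq_mul, mul_one,
      ofReal_measureReal, Measure.restrict_apply ((hY hA).inter mB)]
    congr 1
    ext ω
    simp only [Set.mem_inter_iff]
    tauto
  refine (ae_eq_condExp_of_forall_setIntegral_eq hZX.comap_le iA (fun _ _ _ => ip.integrableOn) ?_
    (sp.mono hle).aestronglyMeasurable).symm
  rintro _ ⟨E, hE, rfl⟩ _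
  have h1 := DFunLike.congr_fun key E
  rw [Measure.map_apply hZX hE, Measure.map_apply hZX hE, Measure.restrict_apply (hZX hE),
    withDensity_apply _ (hZX hE),
    ← ofReal_integral_eq_lintegral_ofReal ip.integrableOn (ae_restrict_of_ae p0),
    ← ofReal_measureReal, ENNReal.ofReal_eq_ofReal_iff measureReal_nonneg
      (setIntegral_nonneg_of_ae p0)] at h1
  rw [← h1, integral_indicator_const _ (hY hA), smul_eq_mul, mul_one,
    measureReal_restrict_apply (hY hA), Set.inter_comm]

end

/-! ### Functional dependence given `X` -/

section

variable {Ω 𝒳 𝒴 𝒵 : Type*} [MeasurableSpace Ω] [MeasurableSpace 𝒳]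
  [MeasurableSpace 𝒴] [StandardBorelSpace 𝒴] [Nonempty 𝒴]
  [MeasurableSpace 𝒵] [StandardBorelSpace 𝒵] [Nonempty 𝒵]
  {P : Measure Ω} [IsProbabilityMeasure P] {X : Ω → 𝒳} {Y : Ω → 𝒴} {Z : Ω → 𝒵}

lemma isFunctionOfGiven_of_eq (hX : Measurable X) (hY : Measurable Y) (hZ : Measurable Z)
    {f : 𝒳 × 𝒵 → 𝒴} (hf : Measurable f) (h : ∀ᵐ ω ∂P, Y ω = f (X ω, Z ω)) :
    IsFunctionOfGiven P Y Z X := by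
  have hYZ := hY.prodMk hZ
  have h1 : ∀ᵐ q ∂(P.map X ⊗ₘ condDistrib (fun ω => (Y ω, Z ω)) X P), q.2.1 = f (q.1, q.2.2) := by
    rw [compProd_map_condDistrib hYZ.aemeasurable, ae_map_iff (hX.prodMk hYZ).aemeasurable]
    · exact h
    · exact measurableSet_eq_fun (by fun_prop) (by fun_prop)
  filter_upwards [Measure.ae_ae_of_ae_compProd h1] with x hx
  exact ⟨fun z => f (x, z), hf.comp measurable_prodMk_left, hx⟩

/-- The functions f_x need not be chosen measurably in x. But the conditional law of Y given (x, z)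
is almost surely a point mass at f_x(z), and its location is recovered measurably in (x, z) by
embedding 𝒴 in ℝ by θ, taking the mean, and inverting θ. -/
lemma IsFunctionOfGiven.exists_eq (h : IsFunctionOfGiven P Y Z X) (hX : Measurable X)
    (hY : Measurable Y) (hZ : Measurable Z) :
    ∃ f : 𝒳 × 𝒵 → 𝒴, Measurable f ∧ ∀ᵐ ω ∂P, Y ω = f (X ω, Z ω) := by
  have hYZ := hY.prodMk hZ
  obtain ⟨θ, hθ⟩ := exists_measurableEmbedding_real 𝒴
  obtain ⟨r, mr, hr⟩ := hθ.exists_measurable_extend measurable_id fun _ => inferInstance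
  have hr' : ∀ y, r (θ y) = y := fun y => congrFun hr y
  -- The swap puts Z first, because `condKernel` conditions on the first coordinate.
  set κ : Kernel 𝒳 (𝒵 × 𝒴) := (condDistrib (fun ω => (Y ω, Z ω)) X P).map Prod.swap with hκ
  set η : Kernel (𝒳 × 𝒵) 𝒴 := κ.condKernel with hη
  set f : 𝒳 × 𝒵 → 𝒴 := fun q => r (∫ y, θ y ∂(η q)) with hf
  have mf : Measurable f :=
    mr.comp (hθ.measurable.stronglyMeasurable.integral_kernel (κ := η)).measurable
  refine ⟨f, mf, ?_⟩
  have h1 : ∀ᵐ q ∂(P.map X ⊗ₘ condDistrib (fun ω => (Y ω, Z ω)) X P), q.2.1 = f (q.1, q.2.2) := by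
    refine Measure.ae_compProd_of_ae_ae (measurableSet_eq_fun (by fun_prop) (by fun_prop)) ?_
    filter_upwards [h] with x hx
    obtain ⟨g, mg, hg⟩ := hx
    have hκx : ∀ᵐ q ∂(κ x), q.2 = g q.1 := by
      rw [hκ, Kernel.map_apply _ measurable_swap, ae_map_iff measurable_swap.aemeasurable]
      · exact hg
      · exact measurableSet_eq_fun (by fun_prop) (by fun_prop)
    have hdis : κ.fst ⊗ₖ η = κ := Kernel.disintegrate κ η
    have h2 : ∀ᵐ z ∂(κ.fst x), ∀ᵐ y ∂(η (x, z)), y = g z := by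
      rw [← hdis] at hκx
      exact Kernel.ae_ae_of_ae_compProd hκx
    have h3 : ∀ᵐ z ∂(κ.fst x), f (x, z) = g z := by
      filter_upwards [h2] with z hz
      have e : ∫ y, θ y ∂(η (x, z)) = θ (g z) := by
        rw [integral_congr_ae (g := fun _ => θ (g z)) (by
          filter_upwards [hz] with y hy
          rw [hy])]
        simp
      simp only [hf, e, hr']
    have h4 : ∀ᵐ q ∂(condDistrib (fun ω => (Y ω, Z ω)) X P x), f (x, q.2) = g q.2 := by
      have e : κ.fst x = (condDistrib (fun ω => (Y ω, Z ω)) X P x).map Prod.snd := by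
        rw [Kernel.fst_apply, hκ, Kernel.map_apply _ measurable_swap,
          Measure.map_map measurable_fst measurable_swap]
        rfl
      rw [e] at h3
      exact ae_of_ae_map measurable_snd.aemeasurable h3
    filter_upwards [hg, h4] with q a b
    rw [a, b]
  rw [compProd_map_condDistrib hYZ.aemeasurable] at h1
  exact ae_of_ae_map (hX.prodMk hYZ).aemeasurable h1

end

end ChatterjeeXi

end

/-! ### The main theorem -/

theorem mainTheorem2
    {Ω₀ Ω 𝒳 𝒴 𝒵 : Type*} [MeasurableSpace Ω₀] [MeasurableSpace Ω]
    [MeasurableSpace 𝒳] [StandardBorelSpace 𝒳]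
    [MeasurableSpace 𝒴] [StandardBorelSpace 𝒴] [Nonempty 𝒴]
    [MeasurableSpace 𝒵] [StandardBorelSpace 𝒵] [Nonempty 𝒵]
    -- the triple `(X, Y, Z)`
    (P : Measure Ω₀) [IsProbabilityMeasure P]
    (X : Ω₀ → 𝒳) (Y : Ω₀ → 𝒴) (Z : Ω₀ → 𝒵)
    (hX : Measurable X) (hY : Measurable Y) (hZ : Measurable Z)
    (hYX : ¬ ∃ f : 𝒳 → 𝒴, Measurable f ∧ ∀ᵐ ω ∂P, Y ω = f (X ω))
    -- the Borel isomorphisms onto Borel subsets of the real line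
    (φ : 𝒳 → ℝ) (ψ : 𝒴 → ℝ) (δ : 𝒳 × 𝒵 → ℝ)
    (hφ : MeasurableEmbedding φ) (hψ : MeasurableEmbedding ψ) (hδ : MeasurableEmbedding δ)
    -- the i.i.d. data, distributed as `(X, Y, Z)`
    (Q : Measure Ω) [IsProbabilityMeasure Q]
    (Xs : ℕ → Ω → 𝒳) (Ys : ℕ → Ω → 𝒴) (Zs : ℕ → Ω → 𝒵)
    (hXs : ∀ i, Measurable (Xs i)) (hYs : ∀ i, Measurable (Ys i)) (hZs : ∀ i, Measurable (Zs i))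
    (hindep : iIndepFun (fun i ω => (Xs i ω, Ys i ω, Zs i ω)) Q)
    (hlaw : ∀ i, IdentDistrib (fun ω => (Xs i ω, Ys i ω, Zs i ω))
      (fun ω => (X ω, Y ω, Z ω)) Q P)
    -- the increasing rearrangements of the first `n` data, ties broken uniformly at random
    (σX σW : (n : ℕ) → Ω → Equiv.Perm (Fin n))
    (hσX : ∀ n, ChatterjeeXi.IsUniformSort Q
      (fun (i : Fin n) ω => φ (Xs i ω)) (fun (i : Fin n) ω => ψ (Ys i ω)) (σX n))
    (hσW : ∀ n, ChatterjeeXi.IsUniformSort Q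
      (fun (i : Fin n) ω => δ (Xs i ω, Zs i ω)) (fun (i : Fin n) ω => ψ (Ys i ω)) (σW n)) :
    -- `T(Y, Z | X)` is well-defined
    0 < ChatterjeeXi.condDepDen P (fun ω => ψ (Y ω)) X ∧
    -- almost surely `ξ_n(Z, Y | X)` is well-defined for all large `n` and converges to `T`
    (∀ᵐ ω ∂Q,
      (∀ᶠ n : ℕ in atTop,
        ChatterjeeXi.xiDen (fun i : Fin n => ψ (Ys i ω)) ≠ 0 ∧
        1 - ChatterjeeXi.xi (σX n ω) (fun i : Fin n => ψ (Ys i ω)) ≠ 0) ∧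
      Tendsto (fun n : ℕ =>
          ChatterjeeXi.condXi (σW n ω) (σX n ω) (fun i : Fin n => ψ (Ys i ω)))
        atTop (𝓝 (ChatterjeeXi.condDep P (fun ω' => ψ (Y ω')) Z X))) ∧
    ChatterjeeXi.condDep P (fun ω => ψ (Y ω)) Z X ∈ Set.Icc (0 : ℝ) 1 ∧
    (ChatterjeeXi.condDep P (fun ω => ψ (Y ω)) Z X = 0 ↔
      ChatterjeeXi.CondIndepGiven P Y Z X) ∧
    (ChatterjeeXi.condDep P (fun ω => ψ (Y ω)) Z X = 1 ↔
      ∃ f : 𝒳 × 𝒵 → 𝒴, Measurable f ∧ ∀ᵐ ω ∂P, Y ω = f (X ω, Z ω)) ∧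
    (ChatterjeeXi.condDep P (fun ω => ψ (Y ω)) Z X = 1 ↔
      ChatterjeeXi.IsFunctionOfGiven P Y Z X) := by

  have hψY : Measurable fun ω => ψ (Y ω) := hψ.measurable.comp hY
  have hφX : Measurable fun ω => φ (X ω) := hφ.measurable.comp hX
  have hδW : Measurable fun ω => δ (X ω, Z ω) := hδ.measurable.comp (hX.prodMk hZ)
  have hZX : Measurable fun ω => (Z ω, X ω) := hZ.prodMk hX
  have hXZ : Measurable fun ω => (X ω, Z ω) := hX.prodMk hZ
  have hμ : IsProbabilityMeasure (P.map fun ω => ψ (Y ω)) :=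
    Measure.isProbabilityMeasure_map hψY.aemeasurable
  obtain ⟨r, mr, hr⟩ := hψ.exists_measurable_extend measurable_id fun _ => inferInstance
  have hr' : ∀ y, r (ψ y) = y := fun y => congrFun hr y
  -- the σ-algebras generated by the real-valued variables
  have cX : MeasurableSpace.comap (fun ω => φ (X ω)) inferInstance =
      MeasurableSpace.comap X inferInstance := by
    rw [← hφ.comap_eq, MeasurableSpace.comap_comp]
    rfl
  have cW : MeasurableSpace.comap (fun ω => δ (X ω, Z ω)) inferInstance =
      MeasurableSpace.comap (fun ω => (X ω, Z ω)) inferInstance := by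
    rw [← hδ.comap_eq, MeasurableSpace.comap_comp]
    rfl
  have cZX : MeasurableSpace.comap (fun ω => (Z ω, X ω)) inferInstance =
      MeasurableSpace.comap (fun ω => (X ω, Z ω)) inferInstance := by
    rw [← (MeasurableEquiv.prodComm (α := 𝒳) (β := 𝒵)).measurableEmbedding.comap_eq,
      MeasurableSpace.comap_comp]
    rfl
  have hle : MeasurableSpace.comap X inferInstance ≤
      MeasurableSpace.comap (fun ω => (Z ω, X ω)) inferInstance := by
    rintro _ ⟨C, hC, rfl⟩
    exact ⟨Prod.snd ⁻¹' C, measurable_snd hC, rfl⟩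
  set sX : ℝ → ℝ := ChatterjeeXi.condSpread P (fun ω => ψ (Y ω))
    (MeasurableSpace.comap X inferInstance) with hsX
  set sW : ℝ → ℝ := ChatterjeeXi.condSpread P (fun ω => ψ (Y ω))
    (MeasurableSpace.comap (fun ω => (Z ω, X ω)) inferInstance) with hsW
  have kX := ChatterjeeXi.condSpread_intervalControlled (P := P) hX.comap_le hψY
  have kW := ChatterjeeXi.condSpread_intervalControlled (P := P) hZX.comap_le hψY
  have k0 := ChatterjeeXi.condSpread_intervalControlled (P := P) bot_le hψY
  set BX : ℝ := ∫ t, sX t ∂(P.map fun ω => ψ (Y ω)) with hBX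
  set BW : ℝ := ∫ t, sW t ∂(P.map fun ω => ψ (Y ω)) with hBW
  have hden : ChatterjeeXi.condDepDen P (fun ω => ψ (Y ω)) X = BX := rfl
  have hnum' : ChatterjeeXi.condDepNum P (fun ω => ψ (Y ω)) Z X =
      ∫ t, (sX t - sW t) ∂(P.map fun ω => ψ (Y ω)) := by
    refine integral_congr_ae (ae_of_all _ fun t => ?_)
    exact ChatterjeeXi.integral_condVar_condProb hle hZX.comap_le hψY t
  have hnum : ChatterjeeXi.condDepNum P (fun ω => ψ (Y ω)) Z X = BX - BW := by
    rw [hnum', integral_sub kX.integrable kW.integrable]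
  have hdiff0 : ∀ t, 0 ≤ sX t - sW t := fun t =>
    sub_nonneg.2 (ChatterjeeXi.condSpread_le_of_le hle hZX.comap_le hψY t)
  have hBW0 : 0 ≤ BW := integral_nonneg fun t => ChatterjeeXi.condSpread_nonneg hZX.comap_le t
  have hBXW : 0 ≤ BX - BW := by
    rw [← hnum, hnum']
    exact integral_nonneg hdiff0
  -- If BX vanished, ψ(Y) would be a function of X, and the left inverse `r` of ψ would make Y one
  -- too, against `hYX`.
  have hBX0 : 0 < BX := by
    refine lt_of_le_of_ne (integral_nonneg fun t => ChatterjeeXi.condSpread_nonneg hX.comap_le t)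
      fun h => hYX ?_
    obtain ⟨f, hf, hfY⟩ := (ChatterjeeXi.integral_condSpread_eq_zero_iff hψY hX).1 h.symm
    refine ⟨r ∘ f, mr.comp hf, ?_⟩
    filter_upwards [hfY] with ω hω
    rw [Function.comp, ← hω, hr']
  -- Conditioning on less increases the spread, so the unconditional spread is at least BX.
  have hD0 : 0 < ∫ t, ChatterjeeXi.condSpread P (fun ω => ψ (Y ω)) ⊥ t ∂(P.map fun ω => ψ (Y ω)) :=
    hBX0.trans_le (integral_mono kX.integrable k0.integrable fun t =>
      ChatterjeeXi.condSpread_le_of_le bot_le hX.comap_le hψY t)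
  have hT : ChatterjeeXi.condDep P (fun ω => ψ (Y ω)) Z X = (BX - BW) / BX := by
    rw [ChatterjeeXi.condDep, hnum, hden]
  have hT1 : ChatterjeeXi.condDep P (fun ω => ψ (Y ω)) Z X = 1 ↔
      ∃ f : 𝒳 × 𝒵 → 𝒴, Measurable f ∧ ∀ᵐ ω ∂P, Y ω = f (X ω, Z ω) := by
    have e : ChatterjeeXi.condDep P (fun ω => ψ (Y ω)) Z X = 1 ↔ BW = 0 := by
      rw [hT, div_eq_one_iff_eq hBX0.ne', sub_eq_self]
    have e2 := ChatterjeeXi.integral_condSpread_eq_zero_iff (P := P) hψY hXZ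
    rw [← cZX] at e2
    rw [e, hBW, hsW, e2]
    constructor
    · rintro ⟨f, hf, h⟩
      refine ⟨r ∘ f, mr.comp hf, ?_⟩
      filter_upwards [h] with ω hω
      rw [Function.comp, ← hω, hr']
    · rintro ⟨f, hf, h⟩
      refine ⟨ψ ∘ f, hψ.measurable.comp hf, ?_⟩
      filter_upwards [h] with ω hω
      rw [Function.comp, ← hω]
  refine ⟨hden ▸ hBX0, ?_, ?_, ?_, hT1, ?_⟩
  · have iX : iIndepFun (fun i ω => (φ (Xs i ω), ψ (Ys i ω))) Q :=
      hindep.comp (fun _ p => (φ p.1, ψ p.2.1)) fun _ =>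
        (hφ.measurable.comp measurable_fst).prodMk (hψ.measurable.comp (by fun_prop))
    have iW : iIndepFun (fun i ω => (δ (Xs i ω, Zs i ω), ψ (Ys i ω))) Q :=
      hindep.comp (fun _ p => (δ (p.1, p.2.2), ψ p.2.1)) fun _ =>
        (hδ.measurable.comp (by fun_prop)).prodMk (hψ.measurable.comp (by fun_prop))
    have lX : ∀ i, IdentDistrib (fun ω => (φ (Xs i ω), ψ (Ys i ω)))
        (fun ω => (φ (X ω), ψ (Y ω))) Q P := fun i =>
      (hlaw i).comp (u := fun p : 𝒳 × 𝒴 × 𝒵 => (φ p.1, ψ p.2.1))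
        ((hφ.measurable.comp measurable_fst).prodMk (hψ.measurable.comp (by fun_prop)))
    have lW : ∀ i, IdentDistrib (fun ω => (δ (Xs i ω, Zs i ω), ψ (Ys i ω)))
        (fun ω => (δ (X ω, Z ω), ψ (Y ω))) Q P := fun i =>
      (hlaw i).comp (u := fun p : 𝒳 × 𝒴 × 𝒵 => (δ (p.1, p.2.2), ψ p.2.1))
        ((hδ.measurable.comp (by fun_prop)).prodMk (hψ.measurable.comp (by fun_prop)))
    have tX := ChatterjeeXi.tendsto_xi_ae (P := P) (Q := Q)
      (U := fun i ω => φ (Xs i ω)) (V := fun i ω => ψ (Ys i ω))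
      (fun i => hφ.measurable.comp (hXs i)) (fun i => hψ.measurable.comp (hYs i)) hφX hψY iX lX hσX hD0
    have tW := ChatterjeeXi.tendsto_xi_ae (P := P) (Q := Q)
      (U := fun i ω => δ (Xs i ω, Zs i ω)) (V := fun i ω => ψ (Ys i ω))
      (fun i => hδ.measurable.comp ((hXs i).prodMk (hZs i)))
      (fun i => hψ.measurable.comp (hYs i)) hδW hψY iW lW hσW hD0
    rw [cX] at tX
    rw [cW, ← cZX] at tW
    filter_upwards [tX, tW] with ω ⟨hd, hx⟩ ⟨_, hw⟩
    have h1 := hx.const_sub 1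
    rw [sub_sub_cancel] at h1
    have hpos := div_pos hBX0 hD0
    refine ⟨?_, ?_⟩
    · filter_upwards [hd, (tendsto_order.1 h1).1 0 hpos] with n a b
      exact ⟨a, b.ne'⟩
    -- The unconditional spread, common to both limits of ξ_n, cancels and leaves (BX - BW)/BX.
    · have h2 := (hw.sub hx).div h1 hpos.ne'
      refine h2.trans (le_of_eq ?_)
      rw [hT]
      congr 1
      change (1 - BW / _ - (1 - BX / _)) / (BX / _) = _
      field_simp
      ring
  · rw [hT]
    exact ⟨div_nonneg hBXW hBX0.le, (div_le_one hBX0).2 (by linarith)⟩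
  -- T = 0 says that the nonnegative function sX - sW has zero integral, so by interval control it
  -- is zero at every level.
  · rw [hT, div_eq_zero_iff, or_iff_left hBX0.ne', ← hnum, hnum',
      (kX.sub kW).integral_eq_zero_iff hdiff0, ← ChatterjeeXi.condIndepGiven_comp_iff hψ]
    constructor
    · intro h
      exact ChatterjeeXi.condIndepGiven_of_condProb_eq hψY hZ hX fun A hA =>
        ChatterjeeXi.condProb_eq_of_forall_threshold hψY hX hZX.comap_le hle
          (fun t => (ChatterjeeXi.condSpread_eq_iff hle hZX.comap_le hψY t).1 (h t)) hA
    · intro h t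
      exact (ChatterjeeXi.condSpread_eq_iff hle hZX.comap_le hψY t).2
        (h.condProb_eq hψY hZ hX measurableSet_Ici)
  · rw [hT1]
    exact ⟨fun ⟨f, hf, h⟩ => ChatterjeeXi.isFunctionOfGiven_of_eq hX hY hZ hf h,
      fun h => h.exists_eq hX hY hZ⟩
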